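/- Let $d\ge 2$, $m\ge 1$, and let $\mathbf X=(X_1,X_2,\mathbf X_J)$ be a random vector in $\mathbb R^d$ with law $\mathbb P$, where $\mathbf X_J\in\mathbb R^{d-2}$. Let $\mathbf X_i=(X_{i,1},X_{i,2},\mathbf X_{i,J})$, $i\ge1$, be i.i.d. copies of $\mathbf X$. Let $A_1,\dots,A_m\subset\mathbb R^{d-2}$ be Borel sets (possibly overlapping) with $p_k:=\mathbb P(\mathbf X_J\in A_k)>0$, and suppose that, for each $k$, the conditional distribution functions of $X_1$ and of $X_2$ given $\mathbf X_J\in A_k$ are continuous. Population quantities. Let $\tau_k$ be Kendall's tau of $(X_1,X_2)$ given $\mathbf X_J\in A_k$, i.e. $$\tau_k=\mathbb P\big((X_{11}-X_{21})(X_{12}-X_{22})>0\,\big|\,\mathbf X_{1,J},\mathbf X_{2,J}\in A_k\big)-\mathbb P\big((X_{11}-X_{21})(X_{12}-X_{22})<0\,\big|\,\mathbf X_{1,J},\mathbf X_{2,J}\in A_k\big).$$ Let $\mathbb P_k$ be the law of $\mathbf X$ given $\mathbf X_J\in A_k$, $p_{k,l}=\mathbb P(\mathbf X_J\in A_k\cap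 A_l)$, $D_k=\mathbb P(X_{11}<X_{21},X_{12}<X_{22},\mathbf X_{1,J}\in A_k,\mathbf X_{2,J}\in A_k)$, $$\pi(\mathbf x,\mathbf y)=\tfrac12\big(\mathbf 1\{x_1<y_1,x_2<y_2\}+\mathbf 1\{y_1<x_1,y_2<x_2\}\big),$$ $$I_{k,l}=\int\mathbf 1\{\mathbf x_{3,J}\in A_k\cap A_l\}\,\pi(\mathbf x_1,\mathbf x_3)\pi(\mathbf x_2,\mathbf x_3)\,\mathbb P_k(d\mathbf x_1)\mathbb P_l(d\mathbf x_2)\mathbb P(d\mathbf x_3),$$ $$J_{k,l}=\int\mathbf 1\{\mathbf x_{2,J}\in A_k\cap A_l\}\,\pi(\mathbf x_1,\mathbf x_2)\,\mathbb P_k(d\mathbf x_1)\mathbb P(d\mathbf x_2),$$ $$\Delta=64\Big[\frac{I_{k,l}}{p_kp_l}+\frac{D_kD_lp_{k,l}}{p_k^3p_l^3}-\frac{D_lJ_{k,l}}{p_kp_l^3}-\frac{D_kJ_{l,k}}{p_lp_k^3}\Big]_{1\le k,l\le m}.$$ Estimators. From the first $n$ observations put $N_k=\#\{i\le n:\mathbf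 X_{i,J}\in A_k\}$, $\hat p_k=N_k/n$, $\hat p_{k,l}=\frac1n\#\{i\le n:\mathbf X_{i,J}\in A_k\cap A_l\}$, $w^{(k)}_i=\mathbf 1\{\mathbf X_{i,J}\in A_k\}/N_k$, $s^{(k)}=\sum_i (w_i^{(k)})^2$, $$\hat\tau_k=\frac{\hat\tau_k^{(1)}+s^{(k)}}{1-s^{(k)}},\qquad \hat\tau_k^{(1)}=4\sum_{i,j}w^{(k)}_iw^{(k)}_j\mathbf 1\{X_{i,1}<X_{j,1},X_{i,2}<X_{j,2}\}-1,$$ $\hat W=\big(\sqrt n(\hat\tau_k-\tau_k)\big)_{1\le k\le m}$, and $$\hat D_k=\frac1{n(n-1)}\sum_{i\ne j}\mathbf 1\{X_{i,1}<X_{j,1},X_{i,2}<X_{j,2},\mathbf X_{i,J}\in A_k,\mathbf X_{j,J}\in A_k\},$$ $$\hat I_{k,l}=\frac1{n^3\hat p_k\hat p_l}\sum_{i_1,i_2,i_3}\pi(\mathbf X_{i_1},\mathbf X_{i_3})\pi(\mathbf X_{i_2},\mathbf X_{i_3})\mathbf 1\{\mathbf X_{i_1,J}\in A_k,\mathbf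 X_{i_2,J}\in A_l,\mathbf X_{i_3,J}\in A_k\cap A_l\},$$ $$\hat J_{k,l}=\frac1{n^2\hat p_k}\sum_{i_1,i_2}\pi(\mathbf X_{i_1},\mathbf X_{i_2})\mathbf 1\{\mathbf X_{i_1,J}\in A_k,\mathbf X_{i_2,J}\in A_k\cap A_l\}.$$ Let $\hat\Delta$ be the plug-in estimator obtained from $\Delta$ by replacing $p_k,p_{k,l},D_k,I_{k,l},J_{k,l}$ by $\hat p_k,\hat p_{k,l},\hat D_k,\hat I_{k,l},\hat J_{k,l}$. Let $T$ be an $(m-1)\times m$ contrast matrix of rank $m-1$: each row has one entry $1$, one entry $-1$ and zeros elsewhere (for example $T=[\mathbf 1_{m-1}:-I_{m-1}]$). Assume that $T\Delta T'$ is nonsingular. Then, under the null hypothesis $\tau_1=\tau_2=\dots=\tau_m$, as $n\to\infty$, the Wald statistic $$\mathcal T_n=\hat W'T'(T\hat\Delta T')^{-1}T\hat W$$ converges in law to the chi-squared distribution with $m-1$ degrees of freedom (the point mass at $0$ if $m=1$). Moreover, if the sets $A_1,\dots,A_m$ are pairwise disjoint, the same conclusion holds when $\hat\Delta$ is replaced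 by the diagonal estimator $$\mathrm{Diag}\Big(16\big(4\hat I_{k,k}/\hat p_k^2-(1+\hat\tau_k)^2/(4\hat p_k)\big)\Big)_{1\le k\le m}.$$ (The value given to $\mathcal T_n$ on the event, of probability tending to $0$, where one of the expressions above is undefined is immaterial.) -/

import Mathlib

open MeasureTheory ProbabilityTheory Filter
open scoped Matrix

noncomputable section

namespace CondKendall

/-- Indicator of a proposition, as a real number. -/
def ind (p : Prop) : ℝ :=
  open Classical in if p then 1 else 0

/-- The space `ℝ^d`, `d = 2 + q`: the first two coordinates are the conditioned variables
`X_1, X_2`, the last `q` coordinates are the conditioning variables `X_J`. -/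
abbrev Vec (q : ℕ) : Type := Fin (2 + q) → ℝ

variable {q m n : ℕ}

/-- The first coordinate `x_1`. -/
def c1 (x : Vec q) : ℝ := x (Fin.castAdd q 0)

/-- The second coordinate `x_2`. -/
def c2 (x : Vec q) : ℝ := x (Fin.castAdd q 1)

/-- The conditioning part `x_J`. -/
def cJ (x : Vec q) : Fin q → ℝ := fun j => x (Fin.natAdd 2 j)

/-- The event `{x_J ∈ A}`. -/
def event (A : Set (Fin q → ℝ)) : Set (Vec q) := {x | cJ x ∈ A}

/-! ### Population quantities, for a law `P` on `ℝ^d` -/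

/-- The law of `X` given `X_J ∈ A`. -/
def condLaw (P : Measure (Vec q)) (A : Set (Fin q → ℝ)) : Measure (Vec q) :=
  ProbabilityTheory.cond P (event A)

/-- The conditional distribution functions `F_{1|J}(· | X_J ∈ A)` and `F_{2|J}(· | X_J ∈ A)`
are continuous. -/
def ContinuousCondMargins (P : Measure (Vec q)) (A : Set (Fin q → ℝ)) : Prop :=
  Continuous (fun t : ℝ => cdf ((condLaw P A).map c1) t) ∧
    Continuous (fun t : ℝ => cdf ((condLaw P A).map c2) t)

/-- The law of two independent versions `(X_1, X_2)` of `X`, given `X_{1,J} ∈ A` and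
`X_{2,J} ∈ A`. -/
def condPairLaw (P : Measure (Vec q)) (A : Set (Fin q → ℝ)) : Measure (Vec q × Vec q) :=
  ProbabilityTheory.cond (P.prod P) {z | cJ z.1 ∈ A ∧ cJ z.2 ∈ A}

/-- Kendall's tau of `(X_1, X_2)` given `X_J ∈ A`: probability of concordance minus
probability of discordance. -/
def condTau (P : Measure (Vec q)) (A : Set (Fin q → ℝ)) : ℝ :=
  (condPairLaw P A).real {z | 0 < (c1 z.1 - c1 z.2) * (c2 z.1 - c2 z.2)} -
    (condPairLaw P A).real {z | (c1 z.1 - c1 z.2) * (c2 z.1 - c2 z.2) < 0}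

/-- The symmetrized concordance kernel `π`. -/
def concord (x y : Vec q) : ℝ :=
  (ind (c1 x < c1 y ∧ c2 x < c2 y) + ind (c1 y < c1 x ∧ c2 y < c2 x)) / 2

/-- `P(X_J ∈ A)`. -/
def prob (P : Measure (Vec q)) (A : Set (Fin q → ℝ)) : ℝ :=
  P.real (event A)

/-- `D = P(X_{i,1} < X_{j,1}, X_{i,2} < X_{j,2}, X_{i,J} ∈ A, X_{j,J} ∈ A)`. -/
def bigD (P : Measure (Vec q)) (A : Set (Fin q → ℝ)) : ℝ :=
  (P.prod P).real {z | c1 z.1 < c1 z.2 ∧ c2 z.1 < c2 z.2 ∧ cJ z.1 ∈ A ∧ cJ z.2 ∈ A}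

/-- `I_{k,l}` for `A = A_k`, `B = A_l`. -/
def bigI (P : Measure (Vec q)) (A B : Set (Fin q → ℝ)) : ℝ :=
  ∫ x₃, ∫ x₂, ∫ x₁, ind (cJ x₃ ∈ A ∩ B) * concord x₁ x₃ * concord x₂ x₃
    ∂(condLaw P A) ∂(condLaw P B) ∂P

/-- `J_{k,l}` for `A = A_k`, `B = A_l`. -/
def bigJ (P : Measure (Vec q)) (A B : Set (Fin q → ℝ)) : ℝ :=
  ∫ x₂, ∫ x₁, ind (cJ x₂ ∈ A ∩ B) * concord x₁ x₂ ∂(condLaw P A) ∂P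

/-- The asymptotic covariance matrix `Δ`. -/
def Delta (P : Measure (Vec q)) (A : Fin m → Set (Fin q → ℝ)) : Matrix (Fin m) (Fin m) ℝ :=
  Matrix.of fun k l =>
    64 * (bigI P (A k) (A l) / (prob P (A k) * prob P (A l))
      + bigD P (A k) * bigD P (A l) * prob P (A k ∩ A l) / (prob P (A k) ^ 3 * prob P (A l) ^ 3)
      - bigD P (A l) * bigJ P (A k) (A l) / (prob P (A k) * prob P (A l) ^ 3)
      - bigD P (A k) * bigJ P (A l) (A k) / (prob P (A l) * prob P (A k) ^ 3))

/-! ### Statistics of a sample `x 0, …, x (n - 1)` -/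

/-- The subsample size `N = #{i : x_{i,J} ∈ A}`. -/
def count (x : Fin n → Vec q) (A : Set (Fin q → ℝ)) : ℝ :=
  ∑ i, ind (cJ (x i) ∈ A)

/-- The weights `w_i = 1{x_{i,J} ∈ A} / N`. -/
def weight (x : Fin n → Vec q) (A : Set (Fin q → ℝ)) (i : Fin n) : ℝ :=
  ind (cJ (x i) ∈ A) / count x A

/-- The raw estimator `τ̂^{(1)}`. -/
def tauHat1 (x : Fin n → Vec q) (A : Set (Fin q → ℝ)) : ℝ :=
  4 * (∑ i, ∑ j, weight x A i * weight x A j *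
    ind (c1 (x i) < c1 (x j) ∧ c2 (x i) < c2 (x j))) - 1

/-- `s = ∑ i, w_i ^ 2`. -/
def sHat (x : Fin n → Vec q) (A : Set (Fin q → ℝ)) : ℝ :=
  ∑ i, weight x A i ^ 2

/-- The empirical conditional Kendall's tau (the rescaled estimator). -/
def tauHat (x : Fin n → Vec q) (A : Set (Fin q → ℝ)) : ℝ :=
  tauHat1 x A / (1 - sHat x A) + sHat x A / (1 - sHat x A)

/-- The vector `Ŵ` with components `√n (τ̂_k - τ_k)`. -/
def WHat (P : Measure (Vec q)) (A : Fin m → Set (Fin q → ℝ)) (x : Fin n → Vec q) :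
    Fin m → ℝ :=
  fun k => Real.sqrt n * (tauHat x (A k) - condTau P (A k))

/-- `p̂ = (1/n) ∑ i, 1{x_{i,J} ∈ A}`. -/
def pHat (x : Fin n → Vec q) (A : Set (Fin q → ℝ)) : ℝ :=
  (1 / (n : ℝ)) * ∑ i, ind (cJ (x i) ∈ A)

/-- The U-statistic `D̂`. -/
def DHat (x : Fin n → Vec q) (A : Set (Fin q → ℝ)) : ℝ :=
  (1 / ((n : ℝ) * ((n : ℝ) - 1))) * ∑ i, ∑ j ∈ Finset.univ.erase i,
    ind (c1 (x i) < c1 (x j) ∧ c2 (x i) < c2 (x j) ∧ cJ (x i) ∈ A ∧ cJ (x j) ∈ A)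

/-- The empirical counterpart of `I_{k,l}`. -/
def IHat (x : Fin n → Vec q) (A B : Set (Fin q → ℝ)) : ℝ :=
  (1 / ((n : ℝ) ^ 3 * (pHat x A * pHat x B))) * ∑ i₁, ∑ i₂, ∑ i₃,
    concord (x i₁) (x i₃) * concord (x i₂) (x i₃) *
      ind (cJ (x i₁) ∈ A ∧ cJ (x i₂) ∈ B ∧ cJ (x i₃) ∈ A ∩ B)

/-- The empirical counterpart of `J_{k,l}`. -/
def JHat (x : Fin n → Vec q) (A B : Set (Fin q → ℝ)) : ℝ :=
  (1 / ((n : ℝ) ^ 2 * pHat x A)) * ∑ i₁, ∑ i₂,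
    concord (x i₁) (x i₂) * ind (cJ (x i₁) ∈ A ∧ cJ (x i₂) ∈ A ∩ B)

/-- The plug-in estimator `Δ̂` for arbitrary (possibly overlapping) conditioning sets. -/
def DeltaHat (A : Fin m → Set (Fin q → ℝ)) (x : Fin n → Vec q) : Matrix (Fin m) (Fin m) ℝ :=
  Matrix.of fun k l =>
    64 * (IHat x (A k) (A l) / (pHat x (A k) * pHat x (A l))
      + DHat x (A k) * DHat x (A l) * pHat x (A k ∩ A l) / (pHat x (A k) ^ 3 * pHat x (A l) ^ 3)
      - DHat x (A l) * JHat x (A k) (A l) / (pHat x (A k) * pHat x (A l) ^ 3)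
      - DHat x (A k) * JHat x (A l) (A k) / (pHat x (A l) * pHat x (A k) ^ 3))

/-- The diagonal plug-in estimator `Δ̂` for pairwise disjoint conditioning sets. -/
def DeltaHatDisjoint (A : Fin m → Set (Fin q → ℝ)) (x : Fin n → Vec q) :
    Matrix (Fin m) (Fin m) ℝ :=
  Matrix.diagonal fun k =>
    16 * (4 * IHat x (A k) (A k) / pHat x (A k) ^ 2
      - (1 + tauHat x (A k)) ^ 2 / (4 * pHat x (A k)))

/-- A contrast matrix: every row has one entry `1`, one entry `-1`, and zeros elsewhere. -/
def IsContrast {r : ℕ} (T : Matrix (Fin r) (Fin m) ℝ) : Prop :=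
  ∀ i, ∃ k l, k ≠ l ∧ T i = Pi.single k 1 - Pi.single l 1

/-- The quadratic form `W' T' (T S T')⁻¹ T W`. -/
def waldStat {r : ℕ} (T : Matrix (Fin r) (Fin m) ℝ) (S : Matrix (Fin m) (Fin m) ℝ)
    (W : Fin m → ℝ) : ℝ :=
  (T *ᵥ W) ⬝ᵥ ((T * S * Tᵀ)⁻¹ *ᵥ (T *ᵥ W))

/-- The chi-squared law with `k` degrees of freedom: the law of the sum of the squares of `k`
independent standard normal variables. -/
def chiSquared (k : ℕ) : Measure ℝ :=
  (Measure.pi fun _ : Fin k => gaussianReal 0 1).map fun z => ∑ i, z i ^ 2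

instance (k : ℕ) : IsProbabilityMeasure (chiSquared k) :=
  Measure.isProbabilityMeasure_map
    (by fun_prop : Measurable fun z : Fin k → ℝ => ∑ i, z i ^ 2).aemeasurable

end CondKendall

end

/-! Each estimator is asymptotically an i.i.d. average, and the quadratic form is a whitened squared
norm up to a factor converging to the identity.

Write g(x) = 1{x_J ∈ A} E[1{X_J ∈ A} π(X, x)] and let U be the V-statistic `pairStat`. Since the
weights give s = 1/(n p̂), the rescaled estimator satisfies 1 + τ̂ = 4U / (p̂ (p̂ - 1/n)), while
continuity of the margins excludes ties and gives 1 + τ = 4D/p². The kernel of U minus its Hájek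
projection is degenerate, so a second moment bound makes its contribution negligible at scale √n
(`tendstoInMeasure_hajek_remainder`). Expanding the quotient then yields √n(τ̂ - τ) = n^{-1/2} ∑
`influence`(X_i) + o_P(1) (`tendstoInMeasure_linearization`). The influence functions are bounded
and centred, and their covariance matrix is exactly `Delta` (`integral_influence_mul`).

Let B be the symmetric square root of TΔT'. The vectors B⁻¹T `influence` have identity covariance,
so the central limit theorem sends B⁻¹TŴ to a standard Gaussian Z. All ingredients of the covariance
estimators are V-statistics of order at most three with bounded kernels, possibly divided by p̂,
hence consistent (`tendstoInMeasure_vstat`). The Wald statistic is the quadratic form of B⁻¹TŴ with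
matrix B(TΔ̂T')⁻¹B, which tends to the identity in probability. Slutsky's theorem gives the limit
|Z|² (`tendstoInDistribution_waldStat`). For disjoint sets `Delta` is diagonal, and the diagonal
estimator is consistent for it. -/

namespace CondKendall

/-! ### Convergence in probability to a constant -/

section ConvergenceInProbability

variable {Ω : Type*} [MeasurableSpace Ω] {μ : Measure Ω}

/-- Because the limit is a constant, continuity at that single point suffices and `f` need not be
measurable. This is what allows quotients and matrix inverses below. -/
theorem tendstoInMeasure_const_comp {E F : Type*} [PseudoEMetricSpace E] [PseudoEMetricSpace F]
    {Y : ℕ → Ω → E} {c : E} {f : E → F} (hf : ContinuousAt f c)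
    (h : TendstoInMeasure μ Y atTop fun _ => c) :
    TendstoInMeasure μ (fun n ω => f (Y n ω)) atTop fun _ => f c := by
  intro ε hε
  obtain ⟨δ, hδ, hδ'⟩ := EMetric.tendsto_nhds_nhds.1 hf ε hε
  refine tendsto_of_tendsto_of_tendsto_of_le_of_le tendsto_const_nhds (h δ hδ)
    (fun _ => zero_le) fun n => measure_mono fun ω hω => ?_
  by_contra hlt
  exact absurd (hδ' (not_le.1 hlt)) (not_lt.2 hω)

theorem tendstoInMeasure_const_prodMk {E F : Type*} [PseudoEMetricSpace E] [PseudoEMetricSpace F]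
    {Y : ℕ → Ω → E} {Z : ℕ → Ω → F} {c : E} {d : F}
    (hY : TendstoInMeasure μ Y atTop fun _ => c) (hZ : TendstoInMeasure μ Z atTop fun _ => d) :
    TendstoInMeasure μ (fun n ω => (Y n ω, Z n ω)) atTop fun _ => (c, d) := by
  intro ε hε
  have h := (hY ε hε).add (hZ ε hε)
  rw [add_zero] at h
  refine tendsto_of_tendsto_of_tendsto_of_le_of_le tendsto_const_nhds h
    (fun _ => zero_le) fun n => (measure_mono fun ω hω => ?_).trans (measure_union_le _ _)
  simpa [Prod.edist_eq] using hω

theorem tendstoInMeasure_const_pi {ι : Type*} [Fintype ι] {E : ι → Type*}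
    [∀ i, PseudoEMetricSpace (E i)] {Y : ℕ → Ω → ∀ i, E i} {c : ∀ i, E i}
    (h : ∀ i, TendstoInMeasure μ (fun n ω => Y n ω i) atTop fun _ => c i) :
    TendstoInMeasure μ Y atTop fun _ => c := by
  intro ε hε
  have h' := tendsto_finsetSum Finset.univ fun i _ => h i ε hε
  rw [Finset.sum_const_zero] at h'
  refine tendsto_of_tendsto_of_tendsto_of_le_of_le tendsto_const_nhds h'
    (fun _ => zero_le) fun n => (measure_mono fun ω hω => ?_).trans
      (measure_biUnion_finset_le Finset.univ _)
  by_contra hlt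
  simp only [Set.mem_iUnion, Finset.mem_univ, exists_true_left, not_exists, Set.mem_ofPred_eq,
    not_le] at hlt
  have : edist (Y n ω) c < ε := by
    -- The product distance is a supremum; positivity of `ε` covers an empty index type, where that
    -- supremum is 0.
    rw [edist_pi_def, Finset.sup_lt_iff (by simpa using hε)]
    exact fun i _ => hlt i
  exact absurd hω (not_le.2 this)

theorem tendstoInMeasure_const_add {Y Z : ℕ → Ω → ℝ} {c d : ℝ}
    (hY : TendstoInMeasure μ Y atTop fun _ => c) (hZ : TendstoInMeasure μ Z atTop fun _ => d) :
    TendstoInMeasure μ (fun n ω => Y n ω + Z n ω) atTop fun _ => c + d := by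
  have h : ContinuousAt (fun z : ℝ × ℝ => z.1 + z.2) (c, d) := by fun_prop
  have h' := tendstoInMeasure_const_comp h (tendstoInMeasure_const_prodMk hY hZ)
  exact h'

theorem tendstoInMeasure_const_sub {Y Z : ℕ → Ω → ℝ} {c d : ℝ}
    (hY : TendstoInMeasure μ Y atTop fun _ => c) (hZ : TendstoInMeasure μ Z atTop fun _ => d) :
    TendstoInMeasure μ (fun n ω => Y n ω - Z n ω) atTop fun _ => c - d := by
  have h : ContinuousAt (fun z : ℝ × ℝ => z.1 - z.2) (c, d) := by fun_prop
  have h' := tendstoInMeasure_const_comp h (tendstoInMeasure_const_prodMk hY hZ)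
  exact h'

theorem tendstoInMeasure_const_mul {Y Z : ℕ → Ω → ℝ} {c d : ℝ}
    (hY : TendstoInMeasure μ Y atTop fun _ => c) (hZ : TendstoInMeasure μ Z atTop fun _ => d) :
    TendstoInMeasure μ (fun n ω => Y n ω * Z n ω) atTop fun _ => c * d := by
  have h : ContinuousAt (fun z : ℝ × ℝ => z.1 * z.2) (c, d) := by fun_prop
  have h' := tendstoInMeasure_const_comp h (tendstoInMeasure_const_prodMk hY hZ)
  exact h'

theorem tendstoInMeasure_const_div {Y Z : ℕ → Ω → ℝ} {c d : ℝ} (hd : d ≠ 0)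
    (hY : TendstoInMeasure μ Y atTop fun _ => c) (hZ : TendstoInMeasure μ Z atTop fun _ => d) :
    TendstoInMeasure μ (fun n ω => Y n ω / Z n ω) atTop fun _ => c / d := by
  have h : ContinuousAt (fun z : ℝ × ℝ => z.1 / z.2) (c, d) :=
    ContinuousAt.div (by fun_prop) (by fun_prop) hd
  have h' := tendstoInMeasure_const_comp h (tendstoInMeasure_const_prodMk hY hZ)
  exact h'

theorem tendstoInMeasure_const_pow {Y : ℕ → Ω → ℝ} {c : ℝ} (k : ℕ)
    (hY : TendstoInMeasure μ Y atTop fun _ => c) :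
    TendstoInMeasure μ (fun n ω => Y n ω ^ k) atTop fun _ => c ^ k :=
  tendstoInMeasure_const_comp (f := fun z : ℝ => z ^ k) (by fun_prop) hY

theorem tendstoInMeasure_of_deterministic {u : ℕ → ℝ} {c : ℝ} (h : Tendsto u atTop (nhds c)) :
    TendstoInMeasure μ (fun n (_ : Ω) => u n) atTop fun _ => c := by
  intro ε hε
  refine tendsto_const_nhds.congr' ?_
  filter_upwards [(EMetric.tendsto_nhds.1 h) ε hε] with n hn
  simp [not_le.2 hn]

theorem tendstoInMeasure_finset_sum {ι : Type*} (s : Finset ι) {Y : ι → ℕ → Ω → ℝ} {c : ι → ℝ}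
    (h : ∀ i ∈ s, TendstoInMeasure μ (Y i) atTop fun _ => c i) :
    TendstoInMeasure μ (fun n ω => ∑ i ∈ s, Y i n ω) atTop fun _ => ∑ i ∈ s, c i := by
  classical
  induction s using Finset.induction_on with
  | empty =>
    simpa using tendstoInMeasure_of_deterministic (μ := μ) (tendsto_const_nhds (x := (0 : ℝ)))
  | insert a s ha ih =>
    simp only [Finset.sum_insert ha]
    exact tendstoInMeasure_const_add (h a (by simp)) (ih fun i hi => h i (by simp [hi]))

/-- Sequences which agree on events `{Q n ∈ U}`, where `Q n` converges in probability to an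
interior point of `U`, have the same limit in probability. -/
theorem tendstoInMeasure_congr_of_mem_nhds {E F : Type*} [PseudoEMetricSpace E]
    [PseudoEMetricSpace F] {Q : ℕ → Ω → F} {b : F} {U : Set F} {Y Z : ℕ → Ω → E} {c : E}
    (hQ : TendstoInMeasure μ Q atTop fun _ => b) (hU : U ∈ nhds b)
    (hYZ : ∀ᶠ n in atTop, ∀ ω, Q n ω ∈ U → Y n ω = Z n ω)
    (hZ : TendstoInMeasure μ Z atTop fun _ => c) :
    TendstoInMeasure μ Y atTop fun _ => c := by
  intro ε hε
  obtain ⟨δ, hδ, hδU⟩ := EMetric.mem_nhds_iff.1 hU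
  have h := (hZ ε hε).add (hQ δ hδ)
  rw [add_zero] at h
  refine tendsto_of_tendsto_of_tendsto_of_le_of_le' tendsto_const_nhds h
    (.of_forall fun _ => zero_le) ?_
  filter_upwards [hYZ] with n hn
  refine (measure_mono fun ω hω => ?_).trans (measure_union_le _ _)
  by_cases hω' : δ ≤ edist (Q n ω) b
  · exact Or.inr hω'
  · have := hn ω (hδU (not_le.1 hω'))
    simp only [Set.mem_ofPred_eq] at hω
    exact Or.inl (by simpa [← this] using hω)

/-- Chebyshev's inequality with an upper bound in place of the second moment. -/
theorem measure_abs_ge_le {Y : Ω → ℝ} {C : ℝ} (hint : Integrable (fun ω => Y ω ^ 2) μ)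
    (hle : ∫ ω, Y ω ^ 2 ∂μ ≤ C) {ε : ℝ} (hε : 0 < ε) :
    μ {ω | ε ≤ |Y ω|} ≤ ENNReal.ofReal (C / ε ^ 2) := by
  have h1 : {ω | ε ≤ |Y ω|} = {ω | ENNReal.ofReal (ε ^ 2) ≤ ENNReal.ofReal (Y ω ^ 2)} := by
    ext ω
    simp only [Set.mem_ofPred_eq]
    rw [ENNReal.ofReal_le_ofReal_iff (sq_nonneg _), ← sq_abs (Y ω),
      sq_le_sq₀ hε.le (abs_nonneg _)]
  rw [h1, ENNReal.ofReal_div_of_pos (by positivity)]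
  refine (meas_ge_le_lintegral_div hint.aemeasurable.ennreal_ofReal (by simpa using hε.ne')
    ENNReal.ofReal_ne_top).trans ?_
  rw [← ofReal_integral_eq_lintegral_ofReal hint (ae_of_all _ fun _ => sq_nonneg _)]
  gcongr

theorem tendstoInMeasure_zero_of_integral_sq_le {Y : ℕ → Ω → ℝ} {b : ℕ → ℝ}
    (hint : ∀ n, Integrable (fun ω => Y n ω ^ 2) μ) (hle : ∀ n, ∫ ω, Y n ω ^ 2 ∂μ ≤ b n)
    (hb : Tendsto b atTop (nhds 0)) : TendstoInMeasure μ Y atTop fun _ => 0 := by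
  rw [tendstoInMeasure_iff_norm]
  intro ε hε
  have h : Tendsto (fun n => ENNReal.ofReal (b n / ε ^ 2)) atTop (nhds 0) := by
    simpa using ENNReal.tendsto_ofReal (hb.div_const (ε ^ 2))
  refine tendsto_of_tendsto_of_tendsto_of_le_of_le tendsto_const_nhds h
    (fun _ => zero_le) fun n => ?_
  simpa using measure_abs_ge_le (hint n) (hle n) hε

/-- The product of a sequence converging to zero in probability and of a sequence bounded
in `L²` converges to zero in probability. -/
theorem tendstoInMeasure_zero_mul_of_integral_sq_le {X Y : ℕ → Ω → ℝ} {C : ℝ}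
    (hX : TendstoInMeasure μ X atTop fun _ => 0)
    (hint : ∀ n, Integrable (fun ω => Y n ω ^ 2) μ) (hle : ∀ n, ∫ ω, Y n ω ^ 2 ∂μ ≤ C) :
    TendstoInMeasure μ (fun n ω => X n ω * Y n ω) atTop fun _ => 0 := by
  rw [tendstoInMeasure_iff_norm] at hX ⊢
  intro ε hε
  rw [ENNReal.tendsto_nhds_zero]
  intro δ hδ
  -- The cut-off `K` makes the Chebyshev bound on the tail of `Y n` at most δ/2 for all n at once;
  -- below it the product can reach ε only if |X n| ≥ ε/K.
  obtain ⟨K, hK, hKδ⟩ : ∃ K : ℝ, 0 < K ∧ ENNReal.ofReal (C / K ^ 2) ≤ δ / 2 := by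
    have h : Tendsto (fun K : ℝ => ENNReal.ofReal (C / K ^ 2)) atTop (nhds 0) := by
      simpa using ENNReal.tendsto_ofReal
        (Tendsto.const_div_atTop (tendsto_pow_atTop (α := ℝ) two_ne_zero) C)
    have h2 := (ENNReal.tendsto_nhds_zero.1 h) (δ / 2) (ENNReal.half_pos hδ.ne')
    obtain ⟨K, hK1, hK2⟩ := ((eventually_gt_atTop (0 : ℝ)).and h2).exists
    exact ⟨K, hK1, hK2⟩
  filter_upwards [(ENNReal.tendsto_nhds_zero.1 (hX (ε / K) (by positivity))) (δ / 2)
    (ENNReal.half_pos hδ.ne')] with n hn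
  calc μ {ω | ε ≤ ‖X n ω * Y n ω - 0‖}
      ≤ μ ({ω | ε / K ≤ ‖X n ω - 0‖} ∪ {ω | K ≤ |Y n ω|}) := by
        refine measure_mono fun ω hω => ?_
        by_contra hc
        simp only [sub_zero, Real.norm_eq_abs, Set.mem_union, Set.mem_ofPred_eq, not_or,
          not_le, abs_mul] at hc hω
        have : |X n ω| * |Y n ω| < ε / K * K :=
          mul_lt_mul'' hc.1 hc.2 (abs_nonneg _) (abs_nonneg _)
        rw [div_mul_cancel₀ _ hK.ne'] at this
        linarith
    _ ≤ δ / 2 + δ / 2 := (measure_union_le _ _).trans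
        (add_le_add hn ((measure_abs_ge_le (hint n) (hle n) hK).trans hKδ))
    _ = δ := ENNReal.add_halves δ

end ConvergenceInProbability

/-! ### Second moments of V-statistics -/

section VStatistics

variable {E : Type*} [MeasurableSpace E] {P : Measure E} [IsProbabilityMeasure P] {n : ℕ}

theorem integrable_of_measurable_of_bound {F : Type*} [MeasurableSpace F] {ν : Measure F}
    [IsFiniteMeasure ν] {f : F → ℝ} (hf : Measurable f) {C : ℝ} (hC : ∀ x, |f x| ≤ C) :
    Integrable f ν :=
  Integrable.of_bound hf.aestronglyMeasurable C (ae_of_all _ hC)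

/-- Fubini: integrating coordinate `i` first, with the others frozen, already gives zero. -/
theorem integral_pi_eq_zero_of_update {F : (Fin n → E) → ℝ} (hF : Measurable F) {C : ℝ}
    (hC : ∀ x, |F x| ≤ C) (i : Fin n) (h : ∀ x, ∫ y, F (Function.update x i y) ∂P = 0) :
    ∫ x, F x ∂(Measure.pi fun _ : Fin n => P) = 0 := by
  obtain _ | n := n
  · exact i.elim0
  have hmp := (measurePreserving_piFinSuccAbove (fun _ : Fin (n + 1) => P) i).symm
  obtain ⟨y₀⟩ : Nonempty E := nonempty_of_isProbabilityMeasure P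
  rw [← hmp.integral_comp' (g := F), integral_prod_symm]
  · refine integral_eq_zero_of_ae (ae_of_all _ fun x => ?_)
    -- The update overwrites coordinate `i`, so the filler `y₀` has no influence.
    simpa [MeasurableEquiv.piFinSuccAbove, Fin.insertNthEquiv] using h (i.insertNth y₀ x)
  · exact integrable_of_measurable_of_bound (hF.comp (MeasurableEquiv.measurable _))
      fun x => hC _

theorem integral_mul_le_of_bound {F : Type*} [MeasurableSpace F] {ν : Measure F}
    [IsProbabilityMeasure ν] {f g : F → ℝ} {C : ℝ} (hf : ∀ x, |f x| ≤ C) (hg : ∀ x, |g x| ≤ C) :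
    ∫ x, f x * g x ∂ν ≤ C ^ 2 := by
  have hC : 0 ≤ C := by
    obtain ⟨y₀⟩ : Nonempty F := nonempty_of_isProbabilityMeasure ν
    exact (abs_nonneg _).trans (hf y₀)
  refine (le_abs_self _).trans ?_
  have := norm_integral_le_of_norm_le_const (μ := ν) (f := fun x => f x * g x) (C := C ^ 2)
    (ae_of_all _ fun x => by
      rw [Real.norm_eq_abs, abs_mul, sq]
      exact mul_le_mul (hf x) (hg x) (abs_nonneg _) hC)
  simpa using this

theorem integral_sq_sum {F ι : Type*} [MeasurableSpace F] {ν : Measure F} [IsProbabilityMeasure ν]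
    (s : Finset ι) {f : ι → F → ℝ} (hf : ∀ i, Measurable (f i)) {C : ℝ}
    (hC : ∀ i x, |f i x| ≤ C) :
    ∫ x, (∑ i ∈ s, f i x) ^ 2 ∂ν = ∑ i ∈ s, ∑ j ∈ s, ∫ x, f i x * f j x ∂ν := by
  have hint : ∀ i j, Integrable (fun x => f i x * f j x) ν := fun i j =>
    integrable_of_measurable_of_bound (C := C * C) ((hf i).mul (hf j)) fun x => by
      rw [abs_mul]
      exact mul_le_mul (hC i x) (hC j x) (abs_nonneg _) ((abs_nonneg _).trans (hC i x))
  simp_rw [sq, Finset.sum_mul_sum]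
  rw [integral_finsetSum _ fun i _ => integrable_finsetSum _ fun j _ => hint i j]
  exact Finset.sum_congr rfl fun i _ => integral_finsetSum _ fun j _ => hint i j

/-- In the expanded square, the term (k, l) vanishes as soon as k differs from i, j and l, by
integrating out coordinate k. Each of the three coincidences leaves n pairs, whence the constant 3n.
-/
theorem integral_sq_sum_last_le {u : E → E → E → ℝ}
    (hu : Measurable fun p : E × E × E => u p.1 p.2.1 p.2.2) {C : ℝ}
    (hC : ∀ x y z, |u x y z| ≤ C) (h0 : ∀ x y, ∫ z, u x y z ∂P = 0) (i j : Fin n) :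
    ∫ x, (∑ k, u (x i) (x j) (x k)) ^ 2 ∂(Measure.pi fun _ : Fin n => P) ≤ 3 * n * C ^ 2 := by
  have hm : ∀ k, Measurable fun x : Fin n → E => u (x i) (x j) (x k) := fun k =>
    hu.comp (by fun_prop : Measurable fun x : Fin n → E => (x i, x j, x k))
  rw [integral_sq_sum _ hm fun k x => hC _ _ _]
  have key : ∀ k l : Fin n, ∫ x, u (x i) (x j) (x k) * u (x i) (x j) (x l)
      ∂(Measure.pi fun _ : Fin n => P) ≤
        C ^ 2 * ((if k = i then 1 else 0) + (if k = j then 1 else 0) +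
          (if l = k then 1 else 0)) := by
    intro k l
    by_cases hk : k = i ∨ k = j ∨ l = k
    · refine (integral_mul_le_of_bound (fun x => hC _ _ _) fun x => hC _ _ _).trans ?_
      refine le_mul_of_one_le_right (sq_nonneg C) ?_
      obtain h | h | h := hk <;> simp only [h, if_true] <;> split_ifs <;> norm_num
    · simp only [not_or] at hk
      obtain ⟨hki, hkj, hkl⟩ := hk
      refine (integral_pi_eq_zero_of_update ((hm k).mul (hm l)) (C := C * C) (fun x => ?_) k
        fun x => ?_).le.trans ?_
      rotate_left
      · simp [Function.update_of_ne (Ne.symm hki), Function.update_of_ne (Ne.symm hkj),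
          Function.update_of_ne hkl, integral_mul_const, h0]
      · simp [hki, hkj, hkl]
      · rw [Pi.mul_apply, abs_mul]
        exact mul_le_mul (hC _ _ _) (hC _ _ _) (abs_nonneg _) ((abs_nonneg _).trans (hC (x i) (x j) (x k)))
  refine (Finset.sum_le_sum fun k _ => Finset.sum_le_sum fun l _ => key k l).trans ?_
  simp only [← Finset.mul_sum, Finset.sum_add_distrib, Finset.sum_const, Finset.card_univ,
    Fintype.card_fin, Finset.sum_ite_eq', Finset.mem_univ, if_true, nsmul_eq_mul,
    mul_one]
  apply le_of_eq
  ring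

/-- Cauchy–Schwarz over the n² pairs (i, j) reduces to the inner sum over k: n⁻⁶ · n² · n² · 3nC² =
3C²/n. Centring in the last argument alone is enough for this rate. -/
theorem integral_sq_vstat_le {u : E → E → E → ℝ}
    (hu : Measurable fun p : E × E × E => u p.1 p.2.1 p.2.2) {C : ℝ}
    (hC : ∀ x y z, |u x y z| ≤ C) (h0 : ∀ x y, ∫ z, u x y z ∂P = 0) :
    ∫ x, (1 / (n : ℝ) ^ 3 * ∑ i, ∑ j, ∑ k, u (x i) (x j) (x k)) ^ 2
      ∂(Measure.pi fun _ : Fin n => P) ≤ 3 * C ^ 2 * (1 / n) := by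
  obtain rfl | hn := Nat.eq_zero_or_pos n
  · simp
  have hn' : (0 : ℝ) < n := by exact_mod_cast hn
  have hm : ∀ i j, Measurable fun x : Fin n → E => ∑ k, u (x i) (x j) (x k) := fun i j =>
    Finset.measurable_fun_sum _ fun k _ =>
      hu.comp (by fun_prop : Measurable fun x : Fin n → E => (x i, x j, x k))
  have hb : ∀ i j, ∀ x : Fin n → E, |∑ k, u (x i) (x j) (x k)| ≤ n * C := fun i j x => by
    refine (Finset.abs_sum_le_sum_abs _ _).trans ?_
    refine (Finset.sum_le_sum fun k _ => hC _ _ _).trans ?_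
    simp
  have hint : ∀ i j, Integrable (fun x : Fin n → E => (∑ k, u (x i) (x j) (x k)) ^ 2)
      (Measure.pi fun _ : Fin n => P) := fun i j =>
    integrable_of_measurable_of_bound (C := (n * C) ^ 2) ((hm i j).pow_const 2) fun x => by
      rw [abs_pow]
      exact pow_le_pow_left₀ (abs_nonneg _) (hb i j x) 2
  calc ∫ x, (1 / (n : ℝ) ^ 3 * ∑ i, ∑ j, ∑ k, u (x i) (x j) (x k)) ^ 2
        ∂(Measure.pi fun _ : Fin n => P)
      ≤ ∫ x, 1 / (n : ℝ) ^ 4 * ∑ i, ∑ j, (∑ k, u (x i) (x j) (x k)) ^ 2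
        ∂(Measure.pi fun _ : Fin n => P) := by
        refine integral_mono_of_nonneg (ae_of_all _ fun _ => sq_nonneg _)
          ((integrable_finsetSum _ fun i _ => integrable_finsetSum _ fun j _ =>
            hint i j).const_mul _) (ae_of_all _ fun x => ?_)
        have h1 := sq_sum_le_card_mul_sum_sq (s := (Finset.univ : Finset (Fin n × Fin n)))
          (f := fun p => ∑ k, u (x p.1) (x p.2) (x k))
        rw [Fintype.sum_prod_type, Fintype.sum_prod_type] at h1
        simp only [Finset.card_univ, Fintype.card_prod, Fintype.card_fin, Nat.cast_mul] at h1
        have h2 := mul_le_mul_of_nonneg_left h1 (by positivity : 0 ≤ 1 / (n : ℝ) ^ 6)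
        simp only
        calc _ = 1 / (n : ℝ) ^ 6 * (∑ i, ∑ j, ∑ k, u (x i) (x j) (x k)) ^ 2 := by
              rw [mul_pow]; congr 1; field_simp
          _ ≤ _ := h2
          _ = _ := by field_simp
    _ = 1 / (n : ℝ) ^ 4 * ∑ i, ∑ j, ∫ x, (∑ k, u (x i) (x j) (x k)) ^ 2
        ∂(Measure.pi fun _ : Fin n => P) := by
        rw [integral_const_mul, integral_finsetSum _ fun i _ =>
          integrable_finsetSum _ fun j _ => hint i j]
        congr 1
        exact Finset.sum_congr rfl fun i _ => integral_finsetSum _ fun j _ => hint i j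
    _ ≤ 1 / (n : ℝ) ^ 4 * ∑ i : Fin n, ∑ j : Fin n, 3 * n * C ^ 2 := by
        gcongr with i _ j _
        exact integral_sq_sum_last_le hu hC h0 i j
    _ = 3 * C ^ 2 * (1 / n) := by
        simp only [Finset.sum_const, Finset.card_univ, Fintype.card_fin, nsmul_eq_mul]
        field_simp

theorem integral_sq_sum_le {f : E → ℝ} (hf : Measurable f) {C : ℝ} (hC : ∀ x, |f x| ≤ C)
    (h0 : ∫ z, f z ∂P = 0) :
    ∫ x, (∑ k, f (x k)) ^ 2 ∂(Measure.pi fun _ : Fin n => P) ≤ 3 * n * C ^ 2 := by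
  obtain _ | n := n
  · simp
  -- The frozen indices are dummies, but they must exist, hence the separate case of an empty
  -- sample.
  · exact integral_sq_sum_last_le (u := fun _ _ z => f z) (by fun_prop) (fun _ _ => hC)
      (fun _ _ => h0) 0 0

/-- A term H(x_i, x_j) H(x_k, x_l) has zero mean if one of its four indices differs from the other
three. Otherwise the indices match up in pairs, in one of three ways, and each way leaves n²
quadruples. The diagonal i = j is included, so V-statistics are covered directly. -/
theorem integral_sq_sum_degenerate_le {H : E → E → ℝ} (hH : Measurable fun p : E × E => H p.1 p.2)
    {C : ℝ} (hC : ∀ x y, |H x y| ≤ C) (h0 : ∀ x, ∫ y, H x y ∂P = 0)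
    (h0' : ∀ y, ∫ x, H x y ∂P = 0) :
    ∫ x, (∑ i, ∑ j, H (x i) (x j)) ^ 2 ∂(Measure.pi fun _ : Fin n => P) ≤
      3 * n ^ 2 * C ^ 2 := by
  have hm : ∀ p : Fin n × Fin n, Measurable fun x : Fin n → E => H (x p.1) (x p.2) := fun p =>
    hH.comp (by fun_prop : Measurable fun x : Fin n → E => (x p.1, x p.2))
  have key : ∀ i j k l : Fin n, ∫ x, H (x i) (x j) * H (x k) (x l)
      ∂(Measure.pi fun _ : Fin n => P) ≤
        C ^ 2 * ((if j = i then 1 else 0) * (if l = k then 1 else 0) +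
          (if k = i then 1 else 0) * (if l = j then 1 else 0) +
          (if l = i then 1 else 0) * (if k = j then 1 else 0)) := by
    intro i j k l
    have hprod : ∀ x : Fin n → E, |H (x i) (x j) * H (x k) (x l)| ≤ C * C := fun x => by
      rw [abs_mul]
      exact mul_le_mul (hC _ _) (hC _ _) (abs_nonneg _) ((abs_nonneg _).trans (hC (x i) (x j)))
    have hmeas := (hm (i, j)).mul (hm (k, l))
    have hnn : (0 : ℝ) ≤ C ^ 2 * ((if j = i then 1 else 0) * (if l = k then 1 else 0) +
          (if k = i then 1 else 0) * (if l = j then 1 else 0) +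
          (if l = i then 1 else 0) * (if k = j then 1 else 0)) := by
      split_ifs <;> positivity
    by_cases hi : j ≠ i ∧ k ≠ i ∧ l ≠ i
    · refine (integral_pi_eq_zero_of_update hmeas hprod i fun x => ?_).le.trans hnn
      simp [Function.update_of_ne hi.1, Function.update_of_ne hi.2.1,
        Function.update_of_ne hi.2.2, integral_mul_const, h0']
    by_cases hj : i ≠ j ∧ k ≠ j ∧ l ≠ j
    · refine (integral_pi_eq_zero_of_update hmeas hprod j fun x => ?_).le.trans hnn
      simp [Function.update_of_ne hj.1, Function.update_of_ne hj.2.1,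
        Function.update_of_ne hj.2.2, integral_mul_const, h0]
    by_cases hk : i ≠ k ∧ j ≠ k ∧ l ≠ k
    · refine (integral_pi_eq_zero_of_update hmeas hprod k fun x => ?_).le.trans hnn
      simp [Function.update_of_ne hk.1, Function.update_of_ne hk.2.1,
        Function.update_of_ne hk.2.2, integral_const_mul, h0']
    by_cases hl : i ≠ l ∧ j ≠ l ∧ k ≠ l
    · refine (integral_pi_eq_zero_of_update hmeas hprod l fun x => ?_).le.trans hnn
      simp [Function.update_of_ne hl.1, Function.update_of_ne hl.2.1,
        Function.update_of_ne hl.2.2, integral_const_mul, h0]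
    refine (integral_mul_le_of_bound (fun x => hC _ _) fun x => hC _ _).trans ?_
    refine le_mul_of_one_le_right (sq_nonneg C) ?_
    have hcases : (j = i ∧ l = k) ∨ (k = i ∧ l = j) ∨ (l = i ∧ k = j) := by grind
    obtain ⟨h1, h2⟩ | ⟨h1, h2⟩ | ⟨h1, h2⟩ := hcases <;> subst h1 <;> subst h2 <;>
      simp only [if_true] <;> split_ifs <;> norm_num
  have hexp := integral_sq_sum (ν := Measure.pi fun _ : Fin n => P) Finset.univ hm
    fun p x => hC _ _
  simp only [Fintype.sum_prod_type] at hexp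
  rw [hexp]
  refine (Finset.sum_le_sum fun i _ => Finset.sum_le_sum fun j _ => Finset.sum_le_sum fun k _ =>
    Finset.sum_le_sum fun l _ => key i j k l).trans ?_
  simp only [← Finset.mul_sum, ← Finset.sum_mul, Finset.sum_add_distrib, Finset.sum_const, Finset.card_univ,
    Fintype.card_fin, Finset.sum_ite_eq', Finset.mem_univ, if_true, nsmul_eq_mul,
    mul_one]
  apply le_of_eq
  ring

end VStatistics

/-! ### Limits of statistics of an i.i.d. sample -/

section Sample

variable {Ω : Type*} [MeasurableSpace Ω] {μ : Measure Ω} [IsProbabilityMeasure μ]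
  {E : Type*} [MeasurableSpace E] {P : Measure E} [IsProbabilityMeasure P] {X : ℕ → Ω → E}

omit [IsProbabilityMeasure P] in
theorem hasLaw_sample (hX : ∀ i, HasLaw (X i) P μ) (hind : iIndepFun X μ) (n : ℕ) :
    HasLaw (fun ω (i : Fin n) => X i ω) (Measure.pi fun _ : Fin n => P) μ where
  aemeasurable := aemeasurable_pi_lambda _ fun i => (hX i).aemeasurable
  map_eq := by
    rw [(iIndepFun_iff_map_fun_eq_pi_map fun i : Fin n => (hX i).aemeasurable).1
      (hind.precomp Fin.val_injective)]
    congr with i : 1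
    exact (hX i).map_eq

omit [IsProbabilityMeasure P] in
theorem tendstoInMeasure_zero_of_integral_pi_sq_le (hX : ∀ i, HasLaw (X i) P μ)
    (hind : iIndepFun X μ) {F : ∀ n, (Fin n → E) → ℝ} (hF : ∀ n, Measurable (F n))
    (hb : ∀ n, ∃ C, ∀ x, |F n x| ≤ C) {b : ℕ → ℝ}
    (hle : ∀ n, ∫ x, F n x ^ 2 ∂(Measure.pi fun _ : Fin n => P) ≤ b n)
    (hlim : Tendsto b atTop (nhds 0)) :
    TendstoInMeasure μ (fun n ω => F n fun i => X i ω) atTop fun _ => 0 := by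
  refine tendstoInMeasure_zero_of_integral_sq_le (b := b) (fun n => ?_) (fun n => ?_) hlim
  · obtain ⟨C, hC⟩ := hb n
    exact Integrable.of_bound (((hF n).comp_aemeasurable
      (hasLaw_sample hX hind n).aemeasurable).pow_const 2).aestronglyMeasurable (C ^ 2)
      (ae_of_all _ fun ω => by
        rw [norm_pow, Real.norm_eq_abs]
        exact pow_le_pow_left₀ (abs_nonneg _) (hC _) 2)
  · refine le_trans (le_of_eq ?_) (hle n)
    exact (hasLaw_sample hX hind n).integral_comp (f := fun x => F n x ^ 2)
      ((hF n).pow_const 2).aestronglyMeasurable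

theorem tendstoInMeasure_vstat_zero (hX : ∀ i, HasLaw (X i) P μ) (hind : iIndepFun X μ)
    {u : E → E → E → ℝ} (hu : Measurable fun p : E × E × E => u p.1 p.2.1 p.2.2) {C : ℝ}
    (hC : ∀ x y z, |u x y z| ≤ C) (h0 : ∀ x y, ∫ z, u x y z ∂P = 0) :
    TendstoInMeasure μ (fun (n : ℕ) ω => 1 / (n : ℝ) ^ 3 *
      ∑ i : Fin n, ∑ j : Fin n, ∑ k : Fin n, u (X i ω) (X j ω) (X k ω)) atTop fun _ => 0 := by
  refine tendstoInMeasure_zero_of_integral_pi_sq_le hX hind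
    (F := fun n x => 1 / (n : ℝ) ^ 3 * ∑ i, ∑ j, ∑ k, u (x i) (x j) (x k)) (fun n => ?_)
    (fun n => ⟨1 / (n : ℝ) ^ 3 * (n * (n * (n * C))), fun x => ?_⟩)
    (fun n => integral_sq_vstat_le hu hC h0) ?_
  · exact (Finset.measurable_fun_sum _ fun i _ => Finset.measurable_fun_sum _ fun j _ =>
      Finset.measurable_fun_sum _ fun k _ =>
        hu.comp (by fun_prop : Measurable fun x : Fin n → E => (x i, x j, x k))).const_mul _
  · rw [abs_mul, abs_of_nonneg (by positivity)]
    refine mul_le_mul_of_nonneg_left ?_ (by positivity)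
    have h1 := Finset.abs_sum_le_sum_abs (fun i => ∑ j, ∑ k, u (x i) (x j) (x k)) Finset.univ
    refine h1.trans ((Finset.sum_le_sum fun i _ => (Finset.abs_sum_le_sum_abs _ _).trans
      (Finset.sum_le_sum fun j _ => (Finset.abs_sum_le_sum_abs _ _).trans
        (Finset.sum_le_sum fun k _ => hC _ _ _))).trans ?_)
    simp
  · simpa using (tendsto_one_div_atTop_nhds_zero_nat (𝕜 := ℝ)).const_mul (3 * C ^ 2)

/-- Law of large numbers for V-statistics of order three with a bounded kernel. -/
theorem tendstoInMeasure_vstat (hX : ∀ i, HasLaw (X i) P μ) (hind : iIndepFun X μ)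
    {h : E → E → E → ℝ} (hh : Measurable fun p : E × E × E => h p.1 p.2.1 p.2.2) {C : ℝ}
    (hC : ∀ x y z, |h x y z| ≤ C) :
    TendstoInMeasure μ (fun (n : ℕ) ω => 1 / (n : ℝ) ^ 3 *
      ∑ i : Fin n, ∑ j : Fin n, ∑ k : Fin n, h (X i ω) (X j ω) (X k ω)) atTop
      fun _ => ∫ x, ∫ y, ∫ z, h x y z ∂P ∂P ∂P := by
  -- Telescoping: h - θ = (h - h2) + (h2 - h1) + (h1 - θ), each bracket centred in its last
  -- variable. The variables are moved to the last slots so that `tendstoInMeasure_vstat_zero`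
  -- applies; unused slots only contribute factors n.
  set h2 : E → E → ℝ := fun x y => ∫ z, h x y z ∂P with h2_def
  set h1 : E → ℝ := fun x => ∫ y, h2 x y ∂P with h1_def
  set θ : ℝ := ∫ x, h1 x ∂P with θ_def
  have m2 : Measurable fun p : E × E => h2 p.1 p.2 := by
    have : StronglyMeasurable (fun q : (E × E) × E => h q.1.1 q.1.2 q.2) :=
      (hh.comp (by fun_prop : Measurable fun q : (E × E) × E => (q.1.1, q.1.2, q.2))).stronglyMeasurable
    exact this.integral_prod_right.measurable
  have m1 : Measurable h1 := m2.stronglyMeasurable.integral_prod_right.measurable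
  have aux : ∀ f : E → ℝ, (∀ x, |f x| ≤ C) → |∫ x, f x ∂P| ≤ C := fun f hf => by
    simpa using norm_integral_le_of_norm_le_const (μ := P) (f := f) (C := C) (ae_of_all _ hf)
  have b2 : ∀ x y, |h2 x y| ≤ C := fun x y => aux _ (hC x y)
  have b1 : ∀ x, |h1 x| ≤ C := fun x => aux _ (b2 x)
  have bθ : |θ| ≤ C := aux _ b1
  have hbd : ∀ a b : ℝ, |a| ≤ C → |b| ≤ C → |a - b| ≤ C + C := fun a b ha hb =>
    (abs_sub _ _).trans (add_le_add ha hb)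
  have t3 := tendstoInMeasure_vstat_zero hX hind (u := fun x y z => h x y z - h2 x y)
    (hh.sub (m2.comp (by fun_prop : Measurable fun p : E × E × E => (p.1, p.2.1))))
    (fun x y z => hbd _ _ (hC x y z) (b2 x y)) fun x y => by
      rw [integral_sub (integrable_of_measurable_of_bound (by fun_prop) (hC x y)) (by simp)]
      simp [h2_def]
  have t2 := tendstoInMeasure_vstat_zero hX hind (u := fun _ y z => h2 y z - h1 y)
    ((m2.comp (by fun_prop : Measurable fun p : E × E × E => (p.2.1, p.2.2))).sub
      (m1.comp (by fun_prop : Measurable fun p : E × E × E => p.2.1)))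
    (fun _ y z => hbd _ _ (b2 y z) (b1 y)) fun _ y => by
      rw [integral_sub (integrable_of_measurable_of_bound (by fun_prop) (b2 y)) (by simp)]
      simp [h1_def]
  have t1 := tendstoInMeasure_vstat_zero hX hind (u := fun _ _ z => h1 z - θ)
    ((m1.comp (by fun_prop : Measurable fun p : E × E × E => p.2.2)).sub_const _)
    (fun _ _ z => hbd _ _ (b1 z) bθ) fun _ _ => by
      rw [integral_sub (integrable_of_measurable_of_bound m1 b1) (by simp)]
      simp [θ_def]
  have t0 := tendstoInMeasure_of_deterministic (μ := μ) (tendsto_const_nhds (x := θ))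
  have ht := tendstoInMeasure_const_add (tendstoInMeasure_const_add
    (tendstoInMeasure_const_add t3 t2) t1) t0
  simp only [add_zero, zero_add] at ht
  refine ht.congr' ?_ (ae_of_all _ fun _ => rfl)
  filter_upwards [eventually_gt_atTop 0] with n hn
  refine ae_of_all _ fun ω => ?_
  have hn' : (n : ℝ) ≠ 0 := by exact_mod_cast hn.ne'
  simp only [Finset.sum_sub_distrib, Finset.sum_const, Finset.card_univ, Fintype.card_fin,
    nsmul_eq_mul, ← Finset.mul_sum]
  field_simp
  ring

/-- Full degeneracy gains a factor n over the plain second moment: 3n²C² divided by (n√n)² is 3C²/n.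
So the double sum is negligible even under the larger scaling needed at rate √n. -/
theorem tendstoInMeasure_sum_degenerate (hX : ∀ i, HasLaw (X i) P μ) (hind : iIndepFun X μ)
    {H : E → E → ℝ} (hH : Measurable fun p : E × E => H p.1 p.2)
    {C : ℝ} (hC : ∀ x y, |H x y| ≤ C) (h0 : ∀ x, ∫ y, H x y ∂P = 0)
    (h0' : ∀ y, ∫ x, H x y ∂P = 0) :
    TendstoInMeasure μ (fun (n : ℕ) ω => 1 / ((n : ℝ) * √n) *
      ∑ i : Fin n, ∑ j : Fin n, H (X i ω) (X j ω)) atTop fun _ => 0 := by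
  refine tendstoInMeasure_zero_of_integral_pi_sq_le hX hind
    (F := fun n x => 1 / ((n : ℝ) * √n) * ∑ i, ∑ j, H (x i) (x j))
    (b := fun n => 3 * C ^ 2 * (1 / n)) (fun n => ?_)
    (fun n => ⟨1 / ((n : ℝ) * √n) * (n * (n * C)), fun x => ?_⟩) (fun n => ?_) ?_
  · exact (Finset.measurable_fun_sum _ fun i _ => Finset.measurable_fun_sum _ fun j _ =>
      hH.comp (by fun_prop : Measurable fun x : Fin n → E => (x i, x j))).const_mul _
  · rw [abs_mul, abs_of_nonneg (by positivity)]
    refine mul_le_mul_of_nonneg_left ?_ (by positivity)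
    refine (Finset.abs_sum_le_sum_abs _ _).trans ((Finset.sum_le_sum fun i _ =>
      (Finset.abs_sum_le_sum_abs _ _).trans (Finset.sum_le_sum fun j _ => hC _ _)).trans ?_)
    simp
  · obtain rfl | hn := Nat.eq_zero_or_pos n
    · simp
    have hn' : (0 : ℝ) < n := by exact_mod_cast hn
    simp_rw [mul_pow]
    rw [integral_const_mul]
    refine (mul_le_mul_of_nonneg_left (integral_sq_sum_degenerate_le hH hC h0 h0')
      (by positivity)).trans (le_of_eq ?_)
    rw [div_pow, mul_pow, Real.sq_sqrt hn'.le]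
    field_simp
  · simpa using (tendsto_one_div_atTop_nhds_zero_nat (𝕜 := ℝ)).const_mul (3 * C ^ 2)

omit [IsProbabilityMeasure P] in
theorem integrable_sq_sum_sample (hX : ∀ i, HasLaw (X i) P μ) {f : E → ℝ} (hf : Measurable f)
    {C : ℝ} (hC : ∀ x, |f x| ≤ C) (c : ℝ) (n : ℕ) :
    Integrable (fun ω => (c * ∑ i : Fin n, f (X i ω)) ^ 2) μ := by
  refine Integrable.of_bound (C := (|c| * (n * C)) ^ 2) ?_ (ae_of_all _ fun ω => ?_)
  · have : ∀ i, AEMeasurable (fun ω => f (X i ω)) μ := fun i =>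
      hf.comp_aemeasurable (hX i).aemeasurable
    exact AEMeasurable.aestronglyMeasurable (by fun_prop)
  · rw [norm_pow, Real.norm_eq_abs, abs_mul]
    refine pow_le_pow_left₀ (by positivity) (mul_le_mul_of_nonneg_left ?_ (abs_nonneg _)) 2
    refine (Finset.abs_sum_le_sum_abs _ _).trans ((Finset.sum_le_sum fun k _ => hC _).trans ?_)
    simp

/-- The bound is uniform in n, as `tendstoInMeasure_zero_mul_of_integral_sq_le` requires of its
second factor. -/
theorem integral_sq_sum_sample_le (hX : ∀ i, HasLaw (X i) P μ) (hind : iIndepFun X μ)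
    {f : E → ℝ} (hf : Measurable f) {C : ℝ} (hC : ∀ x, |f x| ≤ C) (h0 : ∫ z, f z ∂P = 0) (n : ℕ) :
    ∫ ω, ((√n)⁻¹ * ∑ i : Fin n, f (X i ω)) ^ 2 ∂μ ≤ 3 * C ^ 2 := by
  have h := (hasLaw_sample hX hind n).integral_comp
    (f := fun x => ((√n)⁻¹ * ∑ i : Fin n, f (x i)) ^ 2)
    (Measurable.aestronglyMeasurable (by fun_prop))
  refine le_trans (le_of_eq h) ?_
  simp_rw [mul_pow]
  rw [integral_const_mul]
  obtain rfl | hn := Nat.eq_zero_or_pos n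
  · simp; positivity
  have hn' : (0 : ℝ) < n := by exact_mod_cast hn
  refine (mul_le_mul_of_nonneg_left (integral_sq_sum_le hf hC h0) (by positivity)).trans
    (le_of_eq ?_)
  rw [inv_pow, Real.sq_sqrt hn'.le]
  field_simp

/-- Multivariate central limit theorem for bounded functions with identity covariance. -/
theorem tendstoInDistribution_sum_stdGaussian (hX : ∀ i, HasLaw (X i) P μ) (hind : iIndepFun X μ)
    {r : ℕ} {η : E → EuclideanSpace ℝ (Fin r)} (hη : Measurable η) {C : ℝ}
    (hC : ∀ x, ‖η x‖ ≤ C) (h0 : ∀ a, ∫ x, η x a ∂P = 0)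
    (h1 : ∀ a b, ∫ x, η x a * η x b ∂P = (1 : Matrix (Fin r) (Fin r) ℝ) a b) :
    TendstoInDistribution (fun (n : ℕ) ω => (√n)⁻¹ • ∑ i : Fin n, η (X i ω)) atTop
      (fun z : EuclideanSpace ℝ (Fin r) => z) (fun _ => μ)
      (stdGaussian (EuclideanSpace ℝ (Fin r))) where
  forall_aemeasurable n := by
    have : ∀ i, AEMeasurable (fun ω => η (X i ω)) μ := fun i =>
      hη.comp_aemeasurable (hX i).aemeasurable
    fun_prop
  aemeasurable_limit := by fun_prop
  tendsto := by
    have mη : ∀ i, AEMeasurable (fun ω => η (X i ω)) μ := fun i =>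
      hη.comp_aemeasurable (hX i).aemeasurable
    -- Lévy continuity and the Cramér–Wold device: the characteristic function of the vector sum at
    -- t is that of the real sum of ξ = ⟨η, t⟩ at 1. Identity covariance makes the variance of ξ
    -- equal to ‖t‖².
    refine ProbabilityMeasure.tendsto_iff_tendsto_charFun.2 fun t => ?_
    set ξ : E → ℝ := fun x => inner ℝ (η x) t with ξ_def
    have hξ : Measurable ξ := by fun_prop
    have hηa : ∀ a x, |η x a| ≤ C := fun a x => (PiLp.norm_apply_le (η x) a).trans (hC x)
    have hexp : ∀ x, ξ x = ∑ a, t a * η x a := fun x => by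
      simp [ξ_def, PiLp.inner_apply]
    have hma : ∀ a, Measurable fun x => η x a := fun a => by fun_prop
    have hm : ∫ x, ξ x ∂P = 0 := by
      simp_rw [hexp]
      rw [integral_finsetSum _ fun a _ =>
        (integrable_of_measurable_of_bound (hma a) (hηa a)).const_mul _]
      simp [integral_const_mul, h0]
    have hbd : ∀ x, |ξ x| ≤ C * ‖t‖ := fun x => (abs_real_inner_le_norm _ _).trans
      (mul_le_mul_of_nonneg_right (hC x) (norm_nonneg _))
    have hv : ∫ x, ξ x ^ 2 ∂P = ‖t‖ ^ 2 := by
      have hint : ∀ a b, Integrable (fun x => t a * η x a * (t b * η x b)) P := fun a b =>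
        integrable_of_measurable_of_bound (C := |t a| * C * (|t b| * C)) (by fun_prop) fun x => by
          rw [abs_mul, abs_mul, abs_mul]
          exact mul_le_mul (mul_le_mul_of_nonneg_left (hηa a x) (abs_nonneg _))
            (mul_le_mul_of_nonneg_left (hηa b x) (abs_nonneg _)) (by positivity)
            (mul_nonneg (abs_nonneg _) ((abs_nonneg _).trans (hηa a x)))
      simp_rw [hexp, sq, Finset.sum_mul_sum]
      rw [integral_finsetSum _ fun i _ => integrable_finsetSum _ fun j _ => hint i j]
      have : ∀ a, ∫ x, ∑ b, t a * η x a * (t b * η x b) ∂P = t a ^ 2 := fun a => by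
        rw [integral_finsetSum _ fun j _ => hint a j]
        have : ∀ b x, t a * η x a * (t b * η x b) = t a * t b * (η x a * η x b) :=
          fun b x => by ring
        simp_rw [this, integral_const_mul, h1]
        simp [Matrix.one_apply, sq]
      simp_rw [this]
      rw [← sq, EuclideanSpace.norm_sq_eq]
      simp
    have hlaw : ∀ i, ∫ ω, ξ (X i ω) ∂μ = 0 := fun i => by
      rw [← hm]
      exact (hX i).integral_comp hξ.aestronglyMeasurable
    have hvar : Var[fun ω => ξ (X 0 ω); μ] = ‖t‖ ^ 2 := by
      rw [variance_of_integral_eq_zero (X := fun ω => ξ (X 0 ω)) (hξ.comp_aemeasurable (hX 0).aemeasurable) (hlaw 0), ← hv]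
      exact (hX 0).integral_comp (f := fun x => ξ x ^ 2) (hξ.pow_const 2).aestronglyMeasurable
    have hclt := tendstoInDistribution_inv_sqrt_mul_sum_sub (P := μ)
      (X := fun i ω => ξ (X i ω)) (Y := id)
      (P' := gaussianReal 0 Var[fun ω => ξ (X 0 ω); μ].toNNReal)
      HasLaw.id
      (MemLp.of_bound (hξ.comp_aemeasurable (hX 0).aemeasurable).aestronglyMeasurable (C * ‖t‖)
        (ae_of_all _ fun ω => hbd _))
      (hind.comp (fun _ => ξ) fun _ => hξ)
      (fun i => (IdentDistrib.mk (hX i).aemeasurable (hX 0).aemeasurable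
        ((hX i).map_eq.trans (hX 0).map_eq.symm)).comp hξ)
    have hcf := (ProbabilityMeasure.tendsto_iff_tendsto_charFun.1 hclt.tendsto) 1
    simp only [ProbabilityMeasure.coe_mk, Measure.map_id', Measure.map_id] at hcf ⊢
    rw [charFun_stdGaussian]
    rw [charFun_gaussianReal] at hcf
    convert hcf using 1
    · funext n
      rw [charFun_apply, charFun_apply, integral_map (by fun_prop) (by fun_prop),
        integral_map ?_ (by fun_prop)]
      · congr with ω
        simp only [hlaw]
        simp [Finset.sum_range, inner_smul_left, sum_inner, ξ_def]
      · have : ∀ i, AEMeasurable (fun ω => ξ (X i ω)) μ := fun i =>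
          hξ.comp_aemeasurable (hX i).aemeasurable
        fun_prop
    · rw [hvar]
      congr 2
      simp [neg_div]

end Sample

/-! ### Indicators and the concordance kernel -/

section Indicators

theorem ind_nonneg (p : Prop) : 0 ≤ ind p := by
  unfold ind; split_ifs <;> norm_num

theorem ind_le_one (p : Prop) : ind p ≤ 1 := by
  unfold ind; split_ifs <;> norm_num

theorem abs_ind_le_one (p : Prop) : |ind p| ≤ 1 := by
  rw [abs_of_nonneg (ind_nonneg p)]; exact ind_le_one p

theorem ind_true {p : Prop} (h : p) : ind p = 1 := if_pos h

theorem ind_false {p : Prop} (h : ¬p) : ind p = 0 := if_neg h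

theorem ind_and (p q : Prop) : ind (p ∧ q) = ind p * ind q := by
  unfold ind; split_ifs <;> simp_all

theorem ind_mul_self (p : Prop) : ind p * ind p = ind p := by
  rw [← ind_and, and_self_iff]

theorem measurable_ind {E : Type*} [MeasurableSpace E] {p : E → Prop}
    (hp : MeasurableSet {x | p x}) : Measurable fun x => ind (p x) := by
  unfold ind
  exact Measurable.ite hp measurable_const measurable_const

theorem measureReal_eq_integral_ind {E : Type*} [MeasurableSpace E] (ν : Measure E)
    {p : E → Prop} (hp : MeasurableSet {x | p x}) : ν.real {x | p x} = ∫ x, ind (p x) ∂ν := by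
  rw [← integral_indicator_one hp]
  congr with x

variable {q : ℕ}

@[fun_prop]
theorem measurable_c1 : Measurable (c1 : Vec q → ℝ) := by unfold c1; fun_prop

@[fun_prop]
theorem measurable_c2 : Measurable (c2 : Vec q → ℝ) := by unfold c2; fun_prop

@[fun_prop]
theorem measurable_cJ : Measurable (cJ : Vec q → Fin q → ℝ) := by unfold cJ; fun_prop

theorem measurableSet_concordance :
    MeasurableSet {p : Vec q × Vec q | c1 p.1 < c1 p.2 ∧ c2 p.1 < c2 p.2} := by
  have h1 : MeasurableSet {p : Vec q × Vec q | c1 p.1 < c1 p.2} :=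
    measurableSet_lt (by fun_prop) (by fun_prop)
  have h2 : MeasurableSet {p : Vec q × Vec q | c2 p.1 < c2 p.2} :=
    measurableSet_lt (by fun_prop) (by fun_prop)
  exact h1.inter h2

theorem measurable_concordance_ind :
    Measurable fun p : Vec q × Vec q => ind (c1 p.1 < c1 p.2 ∧ c2 p.1 < c2 p.2) :=
  measurable_ind measurableSet_concordance

theorem measurable_concord : Measurable fun p : Vec q × Vec q => concord p.1 p.2 := by
  unfold concord
  exact (measurable_concordance_ind.add
    (measurable_concordance_ind.comp (measurable_snd.prodMk measurable_fst))).div_const 2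

theorem concord_comm (x y : Vec q) : concord x y = concord y x := by
  unfold concord; rw [add_comm]

theorem concord_nonneg (x y : Vec q) : 0 ≤ concord x y := by
  unfold concord
  have := ind_nonneg (c1 x < c1 y ∧ c2 x < c2 y)
  have := ind_nonneg (c1 y < c1 x ∧ c2 y < c2 x)
  positivity

theorem abs_concord_le_one (x y : Vec q) : |concord x y| ≤ 1 := by
  rw [abs_of_nonneg (concord_nonneg x y)]
  unfold concord
  have := ind_le_one (c1 x < c1 y ∧ c2 x < c2 y)
  have := ind_le_one (c1 y < c1 x ∧ c2 y < c2 x)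
  linarith

theorem measurable_ind_cJ {A : Set (Fin q → ℝ)} (hA : MeasurableSet A) :
    Measurable fun x : Vec q => ind (cJ x ∈ A) :=
  measurable_ind (measurable_cJ hA)

theorem measurableSet_event {A : Set (Fin q → ℝ)} (hA : MeasurableSet A) :
    MeasurableSet (event A) :=
  measurable_cJ hA

theorem abs_mul_le_one {a b : ℝ} (ha : |a| ≤ 1) (hb : |b| ≤ 1) : |a * b| ≤ 1 := by
  rw [abs_mul]
  exact mul_le_one₀ ha (abs_nonneg _) hb

end Indicators

/-! ### Population identities -/

section Population

variable {q m : ℕ} {P : Measure (Vec q)} [IsProbabilityMeasure P] {A B : Set (Fin q → ℝ)}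

/-- The partial mean `E[1{X_J ∈ A} π(X, x)]` of the concordance kernel. -/
noncomputable def concordMean (P : Measure (Vec q)) (A : Set (Fin q → ℝ)) (x : Vec q) : ℝ :=
  ∫ y, ind (cJ y ∈ A) * concord y x ∂P

/-- The influence function of the empirical conditional Kendall's tau. -/
noncomputable def influence (P : Measure (Vec q)) (A : Set (Fin q → ℝ)) (x : Vec q) : ℝ :=
  8 / prob P A ^ 2 * (ind (cJ x ∈ A) * concordMean P A x) -
    8 * bigD P A / prob P A ^ 3 * ind (cJ x ∈ A)

omit [IsProbabilityMeasure P] in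
theorem prob_eq_integral (hA : MeasurableSet A) : prob P A = ∫ x, ind (cJ x ∈ A) ∂P :=
  measureReal_eq_integral_ind P (measurable_cJ hA)

theorem measurable_concordMean (hA : MeasurableSet A) : Measurable (concordMean P A) := by
  have : StronglyMeasurable fun p : Vec q × Vec q => ind (cJ p.2 ∈ A) * concord p.2 p.1 :=
    (((measurable_ind_cJ hA).comp measurable_snd).mul
      (measurable_concord.comp (measurable_snd.prodMk measurable_fst))).stronglyMeasurable
  exact this.integral_prod_right.measurable

theorem abs_concordMean_le_one (x : Vec q) : |concordMean P A x| ≤ 1 := by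
  simpa [concordMean] using norm_integral_le_of_norm_le_const (μ := P) (C := 1)
    (f := fun y => ind (cJ y ∈ A) * concord y x)
    (ae_of_all _ fun y => abs_mul_le_one (abs_ind_le_one _) (abs_concord_le_one _ _))

omit [IsProbabilityMeasure P] in
theorem integral_condLaw (hA : MeasurableSet A) (f : Vec q → ℝ) :
    ∫ x, f x ∂(condLaw P A) = (prob P A)⁻¹ * ∫ x, ind (cJ x ∈ A) * f x ∂P := by
  have h : ∀ x, ind (cJ x ∈ A) * f x = (event A).indicator f x := fun x => by
    by_cases hx : cJ x ∈ A <;> simp [event, hx, ind]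
  simp_rw [h]
  rw [integral_indicator (measurableSet_event hA), condLaw, ProbabilityTheory.cond,
    integral_smul_measure, prob, Measure.real, ENNReal.toReal_inv, smul_eq_mul]

omit [IsProbabilityMeasure P] in
-- Given the shared point x₃, the other two points integrate separately, each producing a
-- `concordMean`. Thus I is a mixed second moment of the functions g.
theorem bigI_eq (hA : MeasurableSet A) (hB : MeasurableSet B) :
    bigI P A B = (prob P A * prob P B)⁻¹ * ∫ x, (ind (cJ x ∈ A) * concordMean P A x) *
      (ind (cJ x ∈ B) * concordMean P B x) ∂P := by
  unfold bigI
  rw [← integral_const_mul]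
  congr with x
  simp_rw [integral_condLaw hA, integral_condLaw hB]
  have h1 : ∀ x₂, ∫ x₁, ind (cJ x₁ ∈ A) * (ind (cJ x ∈ A ∩ B) * concord x₁ x * concord x₂ x) ∂P
      = ind (cJ x ∈ A ∩ B) * concord x₂ x * concordMean P A x := fun x₂ => by
    rw [concordMean, ← integral_const_mul]
    congr with x₁
    ring
  simp_rw [h1]
  have h2 : ∀ x₂, ind (cJ x₂ ∈ B) * ((prob P A)⁻¹ * (ind (cJ x ∈ A ∩ B) * concord x₂ x *
      concordMean P A x)) = ((prob P A)⁻¹ * ind (cJ x ∈ A ∩ B) * concordMean P A x) *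
        (ind (cJ x₂ ∈ B) * concord x₂ x) := fun x₂ => by ring
  simp_rw [h2]
  rw [integral_const_mul, ← concordMean, Set.mem_inter_iff, ind_and, mul_inv]
  ring

omit [IsProbabilityMeasure P] in
theorem bigJ_eq (hA : MeasurableSet A) :
    bigJ P A B = (prob P A)⁻¹ * ∫ x, (ind (cJ x ∈ A) * concordMean P A x) *
      ind (cJ x ∈ B) ∂P := by
  unfold bigJ
  rw [← integral_const_mul]
  congr with x
  rw [integral_condLaw hA]
  have h1 : ∀ y, ind (cJ y ∈ A) * (ind (cJ x ∈ A ∩ B) * concord y x)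
      = ind (cJ x ∈ A ∩ B) * (ind (cJ y ∈ A) * concord y x) := fun y => by ring
  simp_rw [h1]
  rw [integral_const_mul, ← concordMean, Set.mem_inter_iff, ind_and]
  ring

theorem measurable_pairKernel (hA : MeasurableSet A) : Measurable fun p : Vec q × Vec q =>
    ind (cJ p.1 ∈ A) * ind (cJ p.2 ∈ A) * ind (c1 p.1 < c1 p.2 ∧ c2 p.1 < c2 p.2) :=
  (((measurable_ind_cJ hA).comp measurable_fst).mul
    ((measurable_ind_cJ hA).comp measurable_snd)).mul measurable_concordance_ind

theorem abs_pairKernel_le_one (x y : Vec q) :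
    |ind (cJ x ∈ A) * ind (cJ y ∈ A) * ind (c1 x < c1 y ∧ c2 x < c2 y)| ≤ 1 :=
  abs_mul_le_one (abs_mul_le_one (abs_ind_le_one _) (abs_ind_le_one _)) (abs_ind_le_one _)

omit [IsProbabilityMeasure P] in
theorem bigD_eq_integral_prod (hA : MeasurableSet A) :
    bigD P A = ∫ z, ind (cJ z.1 ∈ A) * ind (cJ z.2 ∈ A) *
      ind (c1 z.1 < c1 z.2 ∧ c2 z.1 < c2 z.2) ∂(P.prod P) := by
  unfold bigD
  rw [measureReal_eq_integral_ind]
  · congr with z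
    simp only [ind_and]
    ring
  · have h1 : MeasurableSet {z : Vec q × Vec q | cJ z.1 ∈ A ∧ cJ z.2 ∈ A} :=
      (measurable_cJ.comp measurable_fst hA).inter (measurable_cJ.comp measurable_snd hA)
    have h2 := measurableSet_concordance.inter h1
    convert h2 using 1
    ext z
    simp [and_assoc]

theorem bigD_eq_integral_integral (hA : MeasurableSet A) :
    bigD P A = ∫ x, ∫ y, ind (cJ x ∈ A) * ind (cJ y ∈ A) *
      ind (c1 x < c1 y ∧ c2 x < c2 y) ∂P ∂P := by
  rw [bigD_eq_integral_prod hA, integral_prod]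
  exact integrable_of_measurable_of_bound (measurable_pairKernel hA)
    fun z => abs_pairKernel_le_one _ _

theorem bigD_eq_integral_swap (hA : MeasurableSet A) :
    bigD P A = ∫ z, ind (cJ z.1 ∈ A) * ind (cJ z.2 ∈ A) *
      ind (c1 z.2 < c1 z.1 ∧ c2 z.2 < c2 z.1) ∂(P.prod P) := by
  rw [bigD_eq_integral_prod hA, ← integral_prod_swap]
  congr with z
  simp only [Prod.fst_swap, Prod.snd_swap]
  ring

/-- Exchanging the two independent points shows that both orientations in π have mass D, so their
half-sum integrates to D. -/
theorem integral_concordMean (hA : MeasurableSet A) :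
    ∫ x, ind (cJ x ∈ A) * concordMean P A x ∂P = bigD P A := by
  have hm := measurable_pairKernel hA
  have i1 : Integrable (fun z : Vec q × Vec q => ind (cJ z.1 ∈ A) * ind (cJ z.2 ∈ A) *
      ind (c1 z.1 < c1 z.2 ∧ c2 z.1 < c2 z.2)) (P.prod P) :=
    integrable_of_measurable_of_bound hm fun z => abs_pairKernel_le_one _ _
  have i2 : Integrable (fun z : Vec q × Vec q => ind (cJ z.1 ∈ A) * ind (cJ z.2 ∈ A) *
      ind (c1 z.2 < c1 z.1 ∧ c2 z.2 < c2 z.1)) (P.prod P) :=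
    i1.swap.congr (ae_of_all _ fun z => by
      simp only [Function.comp_apply, Prod.fst_swap, Prod.snd_swap]; ring)
  have h : ∫ z, ind (cJ z.1 ∈ A) * (ind (cJ z.2 ∈ A) * concord z.2 z.1) ∂(P.prod P) =
      bigD P A := by
    calc _ = ∫ z, (ind (cJ z.1 ∈ A) * ind (cJ z.2 ∈ A) *
          ind (c1 z.1 < c1 z.2 ∧ c2 z.1 < c2 z.2) + ind (cJ z.1 ∈ A) * ind (cJ z.2 ∈ A) *
          ind (c1 z.2 < c1 z.1 ∧ c2 z.2 < c2 z.1)) / 2 ∂(P.prod P) := by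
          congr with z
          unfold concord
          ring
      _ = _ := by
          rw [integral_div, integral_add i1 i2, ← bigD_eq_integral_prod hA,
            ← bigD_eq_integral_swap hA]
          ring
  rw [← h, integral_prod]
  · simp_rw [integral_const_mul]
    rfl
  · refine integrable_of_measurable_of_bound (C := 1) ?_ fun z => abs_mul_le_one
      (abs_ind_le_one _) (abs_mul_le_one (abs_ind_le_one _) (abs_concord_le_one _ _))
    exact ((measurable_ind_cJ hA).comp measurable_fst).mul
      (((measurable_ind_cJ hA).comp measurable_snd).mul
        (measurable_concord.comp (measurable_snd.prodMk measurable_fst)))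

theorem measurable_influence (hA : MeasurableSet A) : Measurable (influence P A) :=
  (((measurable_ind_cJ hA).mul (measurable_concordMean hA)).const_mul _).sub
    ((measurable_ind_cJ hA).const_mul _)

theorem abs_ind_mul_concordMean_le_one (x : Vec q) :
    |ind (cJ x ∈ A) * concordMean P A x| ≤ 1 :=
  abs_mul_le_one (abs_ind_le_one _) (abs_concordMean_le_one x)

theorem abs_influence_le (x : Vec q) :
    |influence P A x| ≤ |8 / prob P A ^ 2| + |8 * bigD P A / prob P A ^ 3| := by
  unfold influence
  refine (abs_sub _ _).trans (add_le_add ?_ ?_) <;> rw [abs_mul]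
  · exact mul_le_of_le_one_right (abs_nonneg _) (abs_ind_mul_concordMean_le_one x)
  · exact mul_le_of_le_one_right (abs_nonneg _) (abs_ind_le_one _)

theorem integrable_ind_mul_concordMean (hA : MeasurableSet A) :
    Integrable (fun x => ind (cJ x ∈ A) * concordMean P A x) P :=
  integrable_of_measurable_of_bound ((measurable_ind_cJ hA).mul (measurable_concordMean hA))
    abs_ind_mul_concordMean_le_one

theorem integrable_ind_cJ (hA : MeasurableSet A) :
    Integrable (fun x => ind (cJ x ∈ A)) P :=
  integrable_of_measurable_of_bound (measurable_ind_cJ hA) fun _ => abs_ind_le_one _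

theorem integral_influence (hA : MeasurableSet A) (hp : 0 < prob P A) :
    ∫ x, influence P A x ∂P = 0 := by
  unfold influence
  rw [integral_sub ((integrable_ind_mul_concordMean hA).const_mul _)
    ((integrable_ind_cJ hA).const_mul _), integral_const_mul, integral_const_mul,
    integral_concordMean hA, ← prob_eq_integral hA]
  field_simp
  ring

/-- This is the origin of `Delta`: the product of two differences has four terms, whose integrals
are I, J_{k,l}, J_{l,k} and p_{k,l} up to powers of p, and 64 is 8 · 8. -/
theorem integral_influence_mul (hA : MeasurableSet A) (hB : MeasurableSet B)
    (hpA : 0 < prob P A) (hpB : 0 < prob P B) :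
    ∫ x, influence P A x * influence P B x ∂P =
      64 * (bigI P A B / (prob P A * prob P B)
      + bigD P A * bigD P B * prob P (A ∩ B) / (prob P A ^ 3 * prob P B ^ 3)
      - bigD P B * bigJ P A B / (prob P A * prob P B ^ 3)
      - bigD P A * bigJ P B A / (prob P B * prob P A ^ 3)) := by
  have mA := measurable_ind_cJ hA
  have mB := measurable_ind_cJ hB
  have gA := mA.mul (measurable_concordMean (P := P) hA)
  have gB := mB.mul (measurable_concordMean (P := P) hB)
  have iGG : Integrable (fun x => (ind (cJ x ∈ A) * concordMean P A x) *
      (ind (cJ x ∈ B) * concordMean P B x)) P :=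
    integrable_of_measurable_of_bound (gA.mul gB) fun x =>
      abs_mul_le_one (abs_ind_mul_concordMean_le_one x) (abs_ind_mul_concordMean_le_one x)
  have iGB : Integrable (fun x => (ind (cJ x ∈ A) * concordMean P A x) * ind (cJ x ∈ B)) P :=
    integrable_of_measurable_of_bound (gA.mul mB) fun x =>
      abs_mul_le_one (abs_ind_mul_concordMean_le_one x) (abs_ind_le_one _)
  have iAG : Integrable (fun x => (ind (cJ x ∈ B) * concordMean P B x) * ind (cJ x ∈ A)) P :=
    integrable_of_measurable_of_bound (gB.mul mA) fun x =>
      abs_mul_le_one (abs_ind_mul_concordMean_le_one x) (abs_ind_le_one _)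
  have iAB := integrable_ind_cJ (P := P) (hA.inter hB)
  set a := 8 / prob P A ^ 2 with ha
  set a' := 8 * bigD P A / prob P A ^ 3 with ha'
  set b := 8 / prob P B ^ 2 with hb
  set b' := 8 * bigD P B / prob P B ^ 3 with hb'
  have hexp : ∀ x, influence P A x * influence P B x =
      a * b * ((ind (cJ x ∈ A) * concordMean P A x) * (ind (cJ x ∈ B) * concordMean P B x))
      - a * b' * ((ind (cJ x ∈ A) * concordMean P A x) * ind (cJ x ∈ B))
      - a' * b * ((ind (cJ x ∈ B) * concordMean P B x) * ind (cJ x ∈ A))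
      + a' * b' * ind (cJ x ∈ A ∩ B) := fun x => by
    rw [influence, influence, Set.mem_inter_iff, ind_and]
    ring
  simp_rw [hexp]
  rw [integral_add (f := fun x => _ - _ - _) (((iGG.const_mul _).sub (iGB.const_mul _)).sub
    (iAG.const_mul _)) (iAB.const_mul _), integral_sub (f := fun x => _ - _)
    ((iGG.const_mul _).sub (iGB.const_mul _)) (iAG.const_mul _),
    integral_sub (iGG.const_mul _) (iGB.const_mul _), integral_const_mul, integral_const_mul,
    integral_const_mul, integral_const_mul, ← prob_eq_integral (hA.inter hB), bigI_eq hA hB,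
    bigJ_eq hA, bigJ_eq hB, ha, ha', hb, hb']
  field_simp
  ring

theorem cond_margin_null {f : Vec q → ℝ} (hf : Measurable f) (hA : MeasurableSet A)
    (hp : 0 < prob P A) (hc : Continuous fun t : ℝ => cdf ((condLaw P A).map f) t) (t : ℝ) :
    P {x | cJ x ∈ A ∧ f x = t} = 0 := by
  have hp' : P (event A) ≠ 0 := fun h => by simp [prob, Measure.real, h] at hp
  have : IsProbabilityMeasure (condLaw P A) := cond_isProbabilityMeasure hp'
  have : IsProbabilityMeasure ((condLaw P A).map f) :=
    Measure.isProbabilityMeasure_map hf.aemeasurable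
  have h0 : (condLaw P A).map f {t} = 0 := by
    -- The mass of a point is the jump of the distribution function there, zero by continuity.
    rw [← measure_cdf ((condLaw P A).map f), StieltjesFunction.measure_singleton,
      ENNReal.ofReal_eq_zero, sub_nonpos]
    exact (hc.continuousAt.continuousWithinAt.leftLim_eq).ge
  rw [Measure.map_apply hf (measurableSet_singleton t), condLaw,
    cond_apply (measurableSet_event hA)] at h0
  exact (mul_eq_zero.1 h0).resolve_left (by simp)

/-- Fubini: for a fixed second point, a tie forces the first point onto a null level set. -/
theorem ae_prod_ne {f : Vec q → ℝ} (hf : Measurable f) (hA : MeasurableSet A)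
    (hp : 0 < prob P A) (hc : Continuous fun t : ℝ => cdf ((condLaw P A).map f) t) :
    ∀ᵐ z ∂(P.prod P), cJ z.1 ∈ A → f z.1 ≠ f z.2 := by
  have hm : MeasurableSet {z : Vec q × Vec q | cJ z.1 ∈ A ∧ f z.1 = f z.2} :=
    (measurable_cJ.comp measurable_fst hA).inter (measurableSet_eq_fun (by fun_prop) (by fun_prop))
  rw [ae_iff]
  have : {z : Vec q × Vec q | ¬(cJ z.1 ∈ A → f z.1 ≠ f z.2)} =
      {z | cJ z.1 ∈ A ∧ f z.1 = f z.2} := by ext z; simp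
  rw [this, Measure.prod_apply_symm hm]
  simp only [Set.preimage_ofPred_eq, cond_margin_null hf hA hp hc, lintegral_zero]

/-- Concordance has mass 2D. Without ties discordance is its complement, of mass p² - 2D; divide the
difference by p². The continuity assumption enters the proof only through this identity. -/
theorem condTau_eq (hA : MeasurableSet A) (hp : 0 < prob P A)
    (hc : ContinuousCondMargins P A) : condTau P A = 4 * bigD P A / prob P A ^ 2 - 1 := by
  set Q := P.prod P with hQ
  have hR : MeasurableSet {z : Vec q × Vec q | cJ z.1 ∈ A ∧ cJ z.2 ∈ A} :=
    (measurable_cJ.comp measurable_fst hA).inter (measurable_cJ.comp measurable_snd hA)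
  have hRp : Q.real {z : Vec q × Vec q | cJ z.1 ∈ A ∧ cJ z.2 ∈ A} = prob P A ^ 2 := by
    rw [sq, prob, ← measureReal_prod_prod]
    rfl
  have hcond : ∀ s : Vec q × Vec q → Prop, MeasurableSet {z | s z} →
      (condPairLaw P A).real {z | s z} = (prob P A ^ 2)⁻¹ *
        ∫ z, ind (cJ z.1 ∈ A) * ind (cJ z.2 ∈ A) * ind (s z) ∂Q := fun s hs => by
    rw [← hRp, condPairLaw, Measure.real, cond_apply hR, ENNReal.toReal_mul,
      ENNReal.toReal_inv]
    congr 1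
    have := measureReal_eq_integral_ind Q (p := fun z => (cJ z.1 ∈ A ∧ cJ z.2 ∈ A) ∧ s z)
      (hR.inter hs)
    simp only [ind_and] at this
    exact this
  have hprod : Measurable fun z : Vec q × Vec q => (c1 z.1 - c1 z.2) * (c2 z.1 - c2 z.2) := by
    fun_prop
  have hpos := measurableSet_lt (measurable_const (a := (0 : ℝ))) hprod
  have hneg := measurableSet_lt hprod (measurable_const (a := (0 : ℝ)))
  rw [condTau, hcond _ hpos, hcond _ hneg]
  have i1 : Integrable (fun z : Vec q × Vec q => ind (cJ z.1 ∈ A) * ind (cJ z.2 ∈ A) *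
      ind (c1 z.1 < c1 z.2 ∧ c2 z.1 < c2 z.2)) Q :=
    integrable_of_measurable_of_bound (measurable_pairKernel hA) fun z => abs_pairKernel_le_one _ _
  have i2 : Integrable (fun z : Vec q × Vec q => ind (cJ z.1 ∈ A) * ind (cJ z.2 ∈ A) *
      ind (c1 z.2 < c1 z.1 ∧ c2 z.2 < c2 z.1)) Q :=
    i1.swap.congr (ae_of_all _ fun z => by
      simp only [Function.comp_apply, Prod.fst_swap, Prod.snd_swap]; ring)
  have i3 : Integrable (fun z : Vec q × Vec q => ind (cJ z.1 ∈ A) * ind (cJ z.2 ∈ A)) Q :=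
    integrable_of_measurable_of_bound (((measurable_ind_cJ hA).comp measurable_fst).mul
      ((measurable_ind_cJ hA).comp measurable_snd))
      fun z => abs_mul_le_one (abs_ind_le_one _) (abs_ind_le_one _)
  have e1 : ∫ z, ind (cJ z.1 ∈ A) * ind (cJ z.2 ∈ A) *
      ind (0 < (c1 z.1 - c1 z.2) * (c2 z.1 - c2 z.2)) ∂Q = 2 * bigD P A := by
    calc _ = ∫ z, (ind (cJ z.1 ∈ A) * ind (cJ z.2 ∈ A) *
          ind (c1 z.1 < c1 z.2 ∧ c2 z.1 < c2 z.2) + ind (cJ z.1 ∈ A) * ind (cJ z.2 ∈ A) *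
          ind (c1 z.2 < c1 z.1 ∧ c2 z.2 < c2 z.1)) ∂Q := by
          congr with z
          rw [← mul_add]
          congr 1
          simp only [ind, mul_pos_iff, sub_pos, sub_neg]
          split_ifs <;> grind
      _ = _ := by
          rw [integral_add i1 i2, ← bigD_eq_integral_prod hA, ← bigD_eq_integral_swap hA]
          ring
  have e3 : ∫ z, ind (cJ z.1 ∈ A) * ind (cJ z.2 ∈ A) ∂Q = prob P A ^ 2 := by
    rw [← hRp, measureReal_eq_integral_ind Q hR]
    simp only [ind_and]
  have e2 : ∫ z, ind (cJ z.1 ∈ A) * ind (cJ z.2 ∈ A) *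
      ind ((c1 z.1 - c1 z.2) * (c2 z.1 - c2 z.2) < 0) ∂Q = prob P A ^ 2 - 2 * bigD P A := by
    rw [← e1, ← e3, ← integral_sub i3]
    · refine integral_congr_ae ?_
      filter_upwards [ae_prod_ne measurable_c1 hA hp hc.1, ae_prod_ne measurable_c2 hA hp hc.2]
        with z h1 h2
      by_cases hz : cJ z.1 ∈ A
      · have hne : (c1 z.1 - c1 z.2) * (c2 z.1 - c2 z.2) ≠ 0 :=
          mul_ne_zero (sub_ne_zero.2 (h1 hz)) (sub_ne_zero.2 (h2 hz))
        obtain h | h := hne.lt_or_gt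
        · rw [ind_true h, ind_false (not_lt.2 h.le)]; ring
        · rw [ind_true h, ind_false (not_lt.2 h.le)]; ring
      · simp [ind_false hz]
    · exact integrable_of_measurable_of_bound ((((measurable_ind_cJ hA).comp measurable_fst).mul
        ((measurable_ind_cJ hA).comp measurable_snd)).mul (measurable_ind hpos))
        fun z => abs_mul_le_one (abs_mul_le_one (abs_ind_le_one _) (abs_ind_le_one _))
          (abs_ind_le_one _)
  rw [e1, e2]
  field_simp
  ring

end Population

/-! ### Algebra of the sample statistics -/

section Statistics

variable {q n : ℕ} {A B : Set (Fin q → ℝ)}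

/-- The proportion of concordant ordered pairs with both conditioning vectors in `A`. -/
noncomputable def pairStat (x : Fin n → Vec q) (A : Set (Fin q → ℝ)) : ℝ :=
  1 / (n : ℝ) ^ 2 * ∑ i, ∑ j, ind (cJ (x i) ∈ A) * ind (cJ (x j) ∈ A) *
    ind (c1 (x i) < c1 (x j) ∧ c2 (x i) < c2 (x j))

theorem count_eq (x : Fin n → Vec q) (A : Set (Fin q → ℝ)) : count x A = n * pHat x A := by
  obtain rfl | hn := Nat.eq_zero_or_pos n
  · simp [count]
  · rw [count, pHat]
    field_simp

theorem sHat_eq (x : Fin n → Vec q) (A : Set (Fin q → ℝ)) :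
    sHat x A = 1 / n * (1 / pHat x A) := by
  have h : ∑ i, ind (cJ (x i) ∈ A) * ind (cJ (x i) ∈ A) = count x A := by
    simp only [ind_mul_self, count]
  simp only [sHat, weight, div_pow]
  rw [← Finset.sum_div]
  simp only [sq]
  -- The identity N/(N·N) = N⁻¹ also holds for N = 0 with the convention 0⁻¹ = 0, so an empty
  -- subsample needs no separate case.
  rw [h, div_self_mul_self', count_eq]
  rw [one_div_mul_one_div, one_div]

theorem tauHat1_eq (hn : 0 < n) (x : Fin n → Vec q) (A : Set (Fin q → ℝ)) :
    tauHat1 x A = 4 * pairStat x A / pHat x A ^ 2 - 1 := by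
  have h : ∀ i j, weight x A i * weight x A j * ind (c1 (x i) < c1 (x j) ∧ c2 (x i) < c2 (x j)) =
      (ind (cJ (x i) ∈ A) * ind (cJ (x j) ∈ A) *
        ind (c1 (x i) < c1 (x j) ∧ c2 (x i) < c2 (x j))) / (n * pHat x A) ^ 2 := fun i j => by
    rw [weight, weight, count_eq]
    ring
  simp only [tauHat1, h, ← Finset.sum_div, pairStat]
  rw [mul_pow]
  have hn' : (n : ℝ) ≠ 0 := by exact_mod_cast hn.ne'
  field_simp

theorem tauHat_eq (hn : 0 < n) (x : Fin n → Vec q) (A : Set (Fin q → ℝ)) :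
    tauHat x A = (4 * pairStat x A / pHat x A ^ 2 - 1) / (1 - 1 / n * (1 / pHat x A)) +
      1 / n * (1 / pHat x A) / (1 - 1 / n * (1 / pHat x A)) := by
  rw [tauHat, tauHat1_eq hn, sHat_eq]

/-- The strict inequalities kill the diagonal terms, so the U- and V-statistics differ only by their
normalization. -/
theorem DHat_eq (x : Fin n → Vec q) (A : Set (Fin q → ℝ)) :
    DHat x A = (n : ℝ) ^ 2 / ((n : ℝ) * ((n : ℝ) - 1)) * pairStat x A := by
  have h : ∀ i, ∑ j ∈ Finset.univ.erase i, ind (c1 (x i) < c1 (x j) ∧ c2 (x i) < c2 (x j) ∧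
      cJ (x i) ∈ A ∧ cJ (x j) ∈ A) = ∑ j, ind (cJ (x i) ∈ A) * ind (cJ (x j) ∈ A) *
        ind (c1 (x i) < c1 (x j) ∧ c2 (x i) < c2 (x j)) := fun i => by
    rw [Finset.sum_erase (f := fun j => ind (c1 (x i) < c1 (x j) ∧ c2 (x i) < c2 (x j) ∧
      cJ (x i) ∈ A ∧ cJ (x j) ∈ A)) _ (ind_false fun h => lt_irrefl _ h.1)]
    refine Finset.sum_congr rfl fun j _ => ?_
    simp only [ind_and]
    ring
  simp only [DHat, h, pairStat]
  obtain rfl | hn := Nat.eq_zero_or_pos n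
  · simp
  have hn' : (n : ℝ) ≠ 0 := by exact_mod_cast hn.ne'
  field_simp

/-- Symmetrizing the kernel makes its projections on the two arguments coincide. -/
theorem pairStat_eq_concord (x : Fin n → Vec q) (A : Set (Fin q → ℝ)) :
    pairStat x A = 1 / (n : ℝ) ^ 2 * ∑ i, ∑ j, ind (cJ (x i) ∈ A) * ind (cJ (x j) ∈ A) *
      concord (x i) (x j) := by
  rw [pairStat]
  congr 1
  have h : ∑ i, ∑ j, ind (cJ (x i) ∈ A) * ind (cJ (x j) ∈ A) *
      ind (c1 (x i) < c1 (x j) ∧ c2 (x i) < c2 (x j)) =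
      ∑ i, ∑ j, ind (cJ (x i) ∈ A) * ind (cJ (x j) ∈ A) *
      ind (c1 (x j) < c1 (x i) ∧ c2 (x j) < c2 (x i)) := by
    rw [Finset.sum_comm]
    refine Finset.sum_congr rfl fun i _ => Finset.sum_congr rfl fun j _ => ?_
    ring
  have h2 : ∑ i, ∑ j, ind (cJ (x i) ∈ A) * ind (cJ (x j) ∈ A) * concord (x i) (x j) =
      (∑ i, ∑ j, ind (cJ (x i) ∈ A) * ind (cJ (x j) ∈ A) *
      ind (c1 (x i) < c1 (x j) ∧ c2 (x i) < c2 (x j)) +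
      ∑ i, ∑ j, ind (cJ (x i) ∈ A) * ind (cJ (x j) ∈ A) *
      ind (c1 (x j) < c1 (x i) ∧ c2 (x j) < c2 (x i))) / 2 := by
    simp only [← Finset.sum_add_distrib, Finset.sum_div]
    refine Finset.sum_congr rfl fun i _ => Finset.sum_congr rfl fun j _ => ?_
    rw [concord]
    ring
  rw [h2, ← h]
  ring

end Statistics

theorem sum_sum_sum_reverse {ι M : Type*} [Fintype ι] [AddCommMonoid M] (f : ι → ι → ι → M) :
    ∑ i, ∑ j, ∑ k, f i j k = ∑ k, ∑ j, ∑ i, f i j k :=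
  calc ∑ i, ∑ j, ∑ k, f i j k = ∑ i, ∑ k, ∑ j, f i j k :=
        Finset.sum_congr rfl fun _ _ => Finset.sum_comm
    _ = ∑ k, ∑ i, ∑ j, f i j k := Finset.sum_comm
    _ = _ := Finset.sum_congr rfl fun _ _ => Finset.sum_comm

/-! ### Consistency -/

section Consistency

variable {Ω : Type*} [MeasurableSpace Ω] {μ : Measure Ω} [IsProbabilityMeasure μ]
  {q : ℕ} {P : Measure (Vec q)} [IsProbabilityMeasure P] {X : ℕ → Ω → Vec q}
  {A B : Set (Fin q → ℝ)}

omit [IsProbabilityMeasure μ] in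
theorem tendstoInMeasure_one_div_nat :
    TendstoInMeasure μ (fun (n : ℕ) (_ : Ω) => 1 / (n : ℝ)) atTop fun _ => 0 :=
  tendstoInMeasure_of_deterministic tendsto_one_div_atTop_nhds_zero_nat

omit [IsProbabilityMeasure μ] in
theorem tendstoInMeasure_real_const (c : ℝ) :
    TendstoInMeasure μ (fun (_ : ℕ) (_ : Ω) => c) atTop fun _ => c :=
  tendstoInMeasure_of_deterministic tendsto_const_nhds

/-- The law of large numbers of order three serves lower orders as well, through kernels that ignore
some arguments. -/
theorem tendstoInMeasure_pHat (hX : ∀ i, HasLaw (X i) P μ) (hind : iIndepFun X μ)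
    (hA : MeasurableSet A) :
    TendstoInMeasure μ (fun (n : ℕ) ω => pHat (fun i : Fin n => X i ω) A) atTop
      fun _ => prob P A := by
  have h := tendstoInMeasure_vstat hX hind (h := fun x _ _ => ind (cJ x ∈ A))
    ((measurable_ind_cJ hA).comp measurable_fst) (C := 1) fun _ _ _ => abs_ind_le_one _
  simp only [integral_const, probReal_univ, one_smul, ← prob_eq_integral hA] at h
  refine h.congr' ?_ (ae_of_all _ fun _ => rfl)
  filter_upwards [eventually_gt_atTop 0] with n hn
  refine ae_of_all _ fun ω => ?_
  have hn' : (n : ℝ) ≠ 0 := by exact_mod_cast hn.ne'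
  simp only [Finset.sum_const, Finset.card_univ, Fintype.card_fin, nsmul_eq_mul,
    ← Finset.mul_sum, pHat]
  field_simp

theorem tendstoInMeasure_pairStat (hX : ∀ i, HasLaw (X i) P μ) (hind : iIndepFun X μ)
    (hA : MeasurableSet A) :
    TendstoInMeasure μ (fun (n : ℕ) ω => pairStat (fun i : Fin n => X i ω) A) atTop
      fun _ => bigD P A := by
  have h := tendstoInMeasure_vstat hX hind (h := fun x y _ => ind (cJ x ∈ A) * ind (cJ y ∈ A) *
      ind (c1 x < c1 y ∧ c2 x < c2 y))
    ((measurable_pairKernel hA).comp (by fun_prop : Measurable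
      fun p : Vec q × Vec q × Vec q => (p.1, p.2.1))) (C := 1) fun _ _ _ =>
        abs_pairKernel_le_one _ _
  simp only [integral_const, probReal_univ, one_smul, ← bigD_eq_integral_integral hA] at h
  refine h.congr' ?_ (ae_of_all _ fun _ => rfl)
  filter_upwards [eventually_gt_atTop 0] with n hn
  refine ae_of_all _ fun ω => ?_
  have hn' : (n : ℝ) ≠ 0 := by exact_mod_cast hn.ne'
  simp only [Finset.sum_const, Finset.card_univ, Fintype.card_fin, nsmul_eq_mul,
    ← Finset.mul_sum, pairStat]
  field_simp

theorem tendstoInMeasure_DHat (hX : ∀ i, HasLaw (X i) P μ) (hind : iIndepFun X μ)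
    (hA : MeasurableSet A) :
    TendstoInMeasure μ (fun (n : ℕ) ω => DHat (fun i : Fin n => X i ω) A) atTop
      fun _ => bigD P A := by
  have hlim : Tendsto (fun n : ℕ => (n : ℝ) ^ 2 / ((n : ℝ) * ((n : ℝ) - 1))) atTop (nhds 1) := by
    have h1 : Tendsto (fun n : ℕ => 1 / (1 - 1 / (n : ℝ))) atTop (nhds (1 / (1 - 0))) :=
      tendsto_const_nhds.div (tendsto_const_nhds.sub tendsto_one_div_atTop_nhds_zero_nat)
        (by norm_num)
    rw [sub_zero, div_one] at h1
    refine h1.congr' ?_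
    filter_upwards [eventually_gt_atTop 1] with n hn
    have hn' : (1 : ℝ) < n := by exact_mod_cast hn
    have : (n : ℝ) - 1 ≠ 0 := by linarith
    have : (n : ℝ) ≠ 0 := by linarith
    field_simp
  have h := tendstoInMeasure_const_mul (tendstoInMeasure_of_deterministic (μ := μ) hlim)
    (tendstoInMeasure_pairStat hX hind hA)
  simpa only [← DHat_eq, one_mul] using h

theorem tendstoInMeasure_IHat (hX : ∀ i, HasLaw (X i) P μ) (hind : iIndepFun X μ)
    (hA : MeasurableSet A) (hB : MeasurableSet B) (hpA : 0 < prob P A) (hpB : 0 < prob P B) :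
    TendstoInMeasure μ (fun (n : ℕ) ω => IHat (fun i : Fin n => X i ω) A B) atTop
      fun _ => bigI P A B := by
  have hm : Measurable fun p : Vec q × Vec q × Vec q =>
      (ind (cJ p.2.2 ∈ A) * concord p.2.2 p.1) * (ind (cJ p.2.1 ∈ B) * concord p.2.1 p.1) *
        (ind (cJ p.1 ∈ A) * ind (cJ p.1 ∈ B)) := by
    have m1 : Measurable fun p : Vec q × Vec q × Vec q => p.1 := by fun_prop
    have m2 : Measurable fun p : Vec q × Vec q × Vec q => p.2.1 := by fun_prop
    have m3 : Measurable fun p : Vec q × Vec q × Vec q => p.2.2 := by fun_prop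
    exact ((((measurable_ind_cJ hA).comp m3).mul (measurable_concord.comp (m3.prodMk m1))).mul
      (((measurable_ind_cJ hB).comp m2).mul (measurable_concord.comp (m2.prodMk m1)))).mul
        (((measurable_ind_cJ hA).comp m1).mul ((measurable_ind_cJ hB).comp m1))
  have h := tendstoInMeasure_vstat hX hind (h := fun x y z =>
      (ind (cJ z ∈ A) * concord z x) * (ind (cJ y ∈ B) * concord y x) *
        (ind (cJ x ∈ A) * ind (cJ x ∈ B))) hm (C := 1) fun x y z =>
    abs_mul_le_one (abs_mul_le_one (abs_mul_le_one (abs_ind_le_one _) (abs_concord_le_one _ _))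
      (abs_mul_le_one (abs_ind_le_one _) (abs_concord_le_one _ _)))
      (abs_mul_le_one (abs_ind_le_one _) (abs_ind_le_one _))
  have hlim : ∫ x, ∫ y, ∫ z, (ind (cJ z ∈ A) * concord z x) * (ind (cJ y ∈ B) * concord y x) *
        (ind (cJ x ∈ A) * ind (cJ x ∈ B)) ∂P ∂P ∂P = prob P A * prob P B * bigI P A B := by
    rw [bigI_eq hA hB, mul_inv_cancel_left₀ (by positivity)]
    congr with x
    simp_rw [integral_mul_const, integral_const_mul]
    simp only [concordMean]
    ring
  rw [hlim] at h
  have hp := tendstoInMeasure_const_mul (tendstoInMeasure_pHat hX hind hA)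
    (tendstoInMeasure_pHat hX hind hB)
  have h' := tendstoInMeasure_const_div (by positivity) h hp
  rw [mul_div_cancel_left₀ _ (by positivity)] at h'
  refine h'.congr (fun n => ae_of_all _ fun ω => ?_) (ae_of_all _ fun _ => rfl)
  have hsum : ∑ i : Fin n, ∑ j : Fin n, ∑ k : Fin n,
      concord (X i ω) (X k ω) * concord (X j ω) (X k ω) *
        ind (cJ (X i ω) ∈ A ∧ cJ (X j ω) ∈ B ∧ cJ (X k ω) ∈ A ∩ B) =
      ∑ i : Fin n, ∑ j : Fin n, ∑ k : Fin n,
        (ind (cJ (X k ω) ∈ A) * concord (X k ω) (X i ω)) *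
          (ind (cJ (X j ω) ∈ B) * concord (X j ω) (X i ω)) *
          (ind (cJ (X i ω) ∈ A) * ind (cJ (X i ω) ∈ B)) := by
    -- In `IHat` the shared index is summed innermost; making it outermost matches the kernel x, y,
    -- z, whose inner integrals over y and z factor.
    rw [sum_sum_sum_reverse]
    refine Finset.sum_congr rfl fun i _ => Finset.sum_congr rfl fun j _ =>
      Finset.sum_congr rfl fun k _ => ?_
    simp only [ind_and, Set.mem_inter_iff]
    ring
  beta_reduce
  rw [IHat, hsum, one_div_mul_eq_div, one_div_mul_eq_div, div_div]

theorem tendstoInMeasure_JHat (hX : ∀ i, HasLaw (X i) P μ) (hind : iIndepFun X μ)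
    (hA : MeasurableSet A) (hB : MeasurableSet B) (hpA : 0 < prob P A) :
    TendstoInMeasure μ (fun (n : ℕ) ω => JHat (fun i : Fin n => X i ω) A B) atTop
      fun _ => bigJ P A B := by
  have hm : Measurable fun p : Vec q × Vec q × Vec q =>
      (ind (cJ p.2.1 ∈ A) * concord p.2.1 p.1) * (ind (cJ p.1 ∈ A) * ind (cJ p.1 ∈ B)) := by
    have m1 : Measurable fun p : Vec q × Vec q × Vec q => p.1 := by fun_prop
    have m2 : Measurable fun p : Vec q × Vec q × Vec q => p.2.1 := by fun_prop
    exact (((measurable_ind_cJ hA).comp m2).mul (measurable_concord.comp (m2.prodMk m1))).mul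
        (((measurable_ind_cJ hA).comp m1).mul ((measurable_ind_cJ hB).comp m1))
  have h := tendstoInMeasure_vstat hX hind (h := fun x y _ =>
      (ind (cJ y ∈ A) * concord y x) * (ind (cJ x ∈ A) * ind (cJ x ∈ B))) hm (C := 1)
    fun x y z => abs_mul_le_one (abs_mul_le_one (abs_ind_le_one _) (abs_concord_le_one _ _))
      (abs_mul_le_one (abs_ind_le_one _) (abs_ind_le_one _))
  have hlim : ∫ x, ∫ y, ∫ _, (ind (cJ y ∈ A) * concord y x) *
        (ind (cJ x ∈ A) * ind (cJ x ∈ B)) ∂P ∂P ∂P = prob P A * bigJ P A B := by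
    rw [bigJ_eq hA, mul_inv_cancel_left₀ hpA.ne']
    congr with x
    simp_rw [integral_const, probReal_univ, one_smul, integral_mul_const]
    simp only [concordMean]
    ring
  rw [hlim] at h
  have h' := tendstoInMeasure_const_div hpA.ne' h (tendstoInMeasure_pHat hX hind hA)
  rw [mul_div_cancel_left₀ _ hpA.ne'] at h'
  refine h'.congr' ?_ (ae_of_all _ fun _ => rfl)
  filter_upwards [eventually_gt_atTop 0] with n hn
  refine ae_of_all _ fun ω => ?_
  have hn' : (n : ℝ) ≠ 0 := by exact_mod_cast hn.ne'
  simp only [Finset.sum_const, Finset.card_univ, Fintype.card_fin, nsmul_eq_mul,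
    ← Finset.mul_sum]
  have hsum : ∑ i : Fin n, ∑ j : Fin n, concord (X i ω) (X j ω) *
      ind (cJ (X i ω) ∈ A ∧ cJ (X j ω) ∈ A ∩ B) =
      ∑ i : Fin n, ∑ j : Fin n, (ind (cJ (X j ω) ∈ A) * concord (X j ω) (X i ω)) *
        (ind (cJ (X i ω) ∈ A) * ind (cJ (X i ω) ∈ B)) := by
    rw [Finset.sum_comm]
    refine Finset.sum_congr rfl fun i _ => Finset.sum_congr rfl fun j _ => ?_
    simp only [ind_and, Set.mem_inter_iff]
    ring
  rw [JHat, hsum]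
  field_simp

theorem tendstoInMeasure_tauHat (hX : ∀ i, HasLaw (X i) P μ) (hind : iIndepFun X μ)
    (hA : MeasurableSet A) (hpA : 0 < prob P A) (hc : ContinuousCondMargins P A) :
    TendstoInMeasure μ (fun (n : ℕ) ω => tauHat (fun i : Fin n => X i ω) A) atTop
      fun _ => condTau P A := by
  have hp := tendstoInMeasure_pHat hX hind hA
  have hd := tendstoInMeasure_pairStat hX hind hA
  have one := tendstoInMeasure_real_const (μ := μ) 1
  have hs := tendstoInMeasure_const_mul tendstoInMeasure_one_div_nat
    (tendstoInMeasure_const_div hpA.ne' one hp)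
  have hs' := tendstoInMeasure_const_sub one hs
  have hne : (1 : ℝ) - 0 * (1 / prob P A) ≠ 0 := by simp
  have h := tendstoInMeasure_const_add (tendstoInMeasure_const_div hne (tendstoInMeasure_const_sub
    (tendstoInMeasure_const_div (pow_pos hpA 2).ne'
      (tendstoInMeasure_const_mul (tendstoInMeasure_real_const (μ := μ) 4) hd)
      (tendstoInMeasure_const_pow 2 hp)) one) hs') (tendstoInMeasure_const_div hne hs hs')
  rw [condTau_eq hA hpA hc]
  simp only [zero_mul, sub_zero, div_one, add_zero] at h
  refine h.congr' ?_ (ae_of_all _ fun _ => rfl)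
  filter_upwards [eventually_gt_atTop 0] with n hn
  exact ae_of_all _ fun ω => (tauHat_eq hn _ _).symm

theorem tendstoInMeasure_DeltaHat {m : ℕ} {A : Fin m → Set (Fin q → ℝ)}
    (hX : ∀ i, HasLaw (X i) P μ) (hind : iIndepFun X μ) (hA : ∀ k, MeasurableSet (A k))
    (hp : ∀ k, 0 < prob P (A k)) (k l : Fin m) :
    TendstoInMeasure μ (fun (n : ℕ) ω => DeltaHat A (fun i : Fin n => X i ω) k l) atTop
      fun _ => Delta P A k l := by
  have pk := tendstoInMeasure_pHat hX hind (hA k)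
  have pl := tendstoInMeasure_pHat hX hind (hA l)
  have pkl := tendstoInMeasure_pHat hX hind ((hA k).inter (hA l))
  have dk := tendstoInMeasure_DHat hX hind (hA k)
  have dl := tendstoInMeasure_DHat hX hind (hA l)
  have i := tendstoInMeasure_IHat hX hind (hA k) (hA l) (hp k) (hp l)
  have jk := tendstoInMeasure_JHat hX hind (hA k) (hA l) (hp k)
  have jl := tendstoInMeasure_JHat hX hind (hA l) (hA k) (hp l)
  have hk := (hp k).ne'
  have hl := (hp l).ne'
  exact tendstoInMeasure_const_mul (tendstoInMeasure_real_const 64)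
    (tendstoInMeasure_const_sub (tendstoInMeasure_const_sub (tendstoInMeasure_const_add
      (tendstoInMeasure_const_div (mul_ne_zero hk hl) i (tendstoInMeasure_const_mul pk pl))
      (tendstoInMeasure_const_div (mul_ne_zero (pow_ne_zero 3 hk) (pow_ne_zero 3 hl))
        (tendstoInMeasure_const_mul (tendstoInMeasure_const_mul dk dl) pkl)
        (tendstoInMeasure_const_mul (tendstoInMeasure_const_pow 3 pk)
          (tendstoInMeasure_const_pow 3 pl))))
      (tendstoInMeasure_const_div (mul_ne_zero hk (pow_ne_zero 3 hl))
        (tendstoInMeasure_const_mul dl jk)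
        (tendstoInMeasure_const_mul pk (tendstoInMeasure_const_pow 3 pl))))
      (tendstoInMeasure_const_div (mul_ne_zero hl (pow_ne_zero 3 hk))
        (tendstoInMeasure_const_mul dk jl)
        (tendstoInMeasure_const_mul pl (tendstoInMeasure_const_pow 3 pk))))

omit [IsProbabilityMeasure P] in
theorem prob_eq_zero_of_eq_empty (h : A = ∅) : prob P A = 0 := by
  simp [prob, event, h]

/-- Disjointness annihilates I, J and p_{k,l} off the diagonal. On it J = D/p, so the three D² terms
combine to -D²/p⁵, which is -(1+τ)²/(16p) because 1 + τ = 4D/p². -/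
theorem Delta_eq_diagonal {m : ℕ} {A : Fin m → Set (Fin q → ℝ)} (hA : ∀ k, MeasurableSet (A k))
    (hp : ∀ k, 0 < prob P (A k)) (hc : ∀ k, ContinuousCondMargins P (A k))
    (hdisj : Pairwise fun k l => Disjoint (A k) (A l)) :
    Delta P A = Matrix.diagonal fun k => 16 * (4 * bigI P (A k) (A k) / prob P (A k) ^ 2 -
      (1 + condTau P (A k)) ^ 2 / (4 * prob P (A k))) := by
  ext k l
  by_cases hkl : k = l
  · subst hkl
    have hJ : bigJ P (A k) (A k) = (prob P (A k))⁻¹ * bigD P (A k) := by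
      rw [bigJ_eq (hA k), ← integral_concordMean (hA k)]
      congr with x
      rw [mul_right_comm, ind_mul_self]
    have hk := (hp k).ne'
    rw [Matrix.diagonal_apply_eq, Delta, Matrix.of_apply, hJ, condTau_eq (hA k) (hp k) (hc k),
      Set.inter_self]
    field_simp
    ring
  · have hind0 : ∀ x : Vec q, ind (cJ x ∈ A k) * ind (cJ x ∈ A l) = 0 := fun x => by
      rw [← ind_and]
      exact ind_false fun h => Set.disjoint_left.1 (hdisj hkl) h.1 h.2
    have hI : bigI P (A k) (A l) = 0 := by
      rw [bigI_eq (hA k) (hA l)]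
      have : ∀ x, (ind (cJ x ∈ A k) * concordMean P (A k) x) *
          (ind (cJ x ∈ A l) * concordMean P (A l) x) = 0 := fun x => by
        rw [mul_mul_mul_comm, hind0, zero_mul]
      simp [this]
    have hJ : bigJ P (A k) (A l) = 0 := by
      rw [bigJ_eq (hA k)]
      have : ∀ x, (ind (cJ x ∈ A k) * concordMean P (A k) x) * ind (cJ x ∈ A l) = 0 := fun x => by
        rw [mul_right_comm, hind0, zero_mul]
      simp [this]
    have hJ' : bigJ P (A l) (A k) = 0 := by
      rw [bigJ_eq (hA l)]
      have : ∀ x, (ind (cJ x ∈ A l) * concordMean P (A l) x) * ind (cJ x ∈ A k) = 0 := fun x => by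
        rw [mul_right_comm, mul_comm (ind _), hind0, zero_mul]
      simp [this]
    rw [Matrix.diagonal_apply_ne _ hkl, Delta, Matrix.of_apply, hI, hJ, hJ',
      prob_eq_zero_of_eq_empty (Set.disjoint_iff_inter_eq_empty.1 (hdisj hkl))]
    simp

theorem tendstoInMeasure_DeltaHatDisjoint {m : ℕ} {A : Fin m → Set (Fin q → ℝ)}
    (hX : ∀ i, HasLaw (X i) P μ) (hind : iIndepFun X μ) (hA : ∀ k, MeasurableSet (A k))
    (hp : ∀ k, 0 < prob P (A k)) (hc : ∀ k, ContinuousCondMargins P (A k))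
    (hdisj : Pairwise fun k l => Disjoint (A k) (A l)) (k l : Fin m) :
    TendstoInMeasure μ (fun (n : ℕ) ω => DeltaHatDisjoint A (fun i : Fin n => X i ω) k l) atTop
      fun _ => Delta P A k l := by
  rw [Delta_eq_diagonal hA hp hc hdisj]
  unfold DeltaHatDisjoint
  by_cases hkl : k = l
  · subst hkl
    simp only [Matrix.diagonal_apply_eq]
    have pk := tendstoInMeasure_pHat hX hind (hA k)
    have i := tendstoInMeasure_IHat hX hind (hA k) (hA k) (hp k) (hp k)
    have t := tendstoInMeasure_tauHat hX hind (hA k) (hp k) (hc k)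
    exact tendstoInMeasure_const_mul (tendstoInMeasure_real_const 16)
      (tendstoInMeasure_const_sub
        (tendstoInMeasure_const_div (pow_ne_zero 2 (hp k).ne')
          (tendstoInMeasure_const_mul (tendstoInMeasure_real_const 4) i)
          (tendstoInMeasure_const_pow 2 pk))
        (tendstoInMeasure_const_div (mul_ne_zero four_ne_zero (hp k).ne')
          (tendstoInMeasure_const_pow 2
            (tendstoInMeasure_const_add (tendstoInMeasure_real_const 1) t))
          (tendstoInMeasure_const_mul (tendstoInMeasure_real_const 4) pk)))
  · simp only [Matrix.diagonal_apply_ne _ hkl]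
    exact tendstoInMeasure_real_const 0

end Consistency

/-! ### Linearization -/

section Linearization

variable {Ω : Type*} [MeasurableSpace Ω] {μ : Measure Ω} [IsProbabilityMeasure μ]
  {q : ℕ} {P : Measure (Vec q)} [IsProbabilityMeasure P] {X : ℕ → Ω → Vec q}
  {A : Set (Fin q → ℝ)}

/-- The remainder of the Hájek projection of the concordance statistic vanishes. -/
theorem tendstoInMeasure_hajek_remainder (hX : ∀ i, HasLaw (X i) P μ) (hind : iIndepFun X μ)
    (hA : MeasurableSet A) :
    TendstoInMeasure μ (fun (n : ℕ) ω => √n * (pairStat (fun i : Fin n => X i ω) A - bigD P A) -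
      2 * ((√n)⁻¹ * ∑ i : Fin n, (ind (cJ (X i ω) ∈ A) * concordMean P A (X i ω) - bigD P A)))
      atTop fun _ => 0 := by
  set g : Vec q → ℝ := fun x => ind (cJ x ∈ A) * concordMean P A x with hg
  have mg : Measurable g := (measurable_ind_cJ hA).mul (measurable_concordMean hA)
  have bg : ∀ x, |g x| ≤ 1 := abs_ind_mul_concordMean_le_one
  set K : Vec q → Vec q → ℝ := fun x y => ind (cJ x ∈ A) * ind (cJ y ∈ A) * concord x y with hK
  have mK : Measurable fun p : Vec q × Vec q => K p.1 p.2 :=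
    (((measurable_ind_cJ hA).comp measurable_fst).mul
      ((measurable_ind_cJ hA).comp measurable_snd)).mul measurable_concord
  have bK : ∀ x y, |K x y| ≤ 1 := fun x y =>
    abs_mul_le_one (abs_mul_le_one (abs_ind_le_one _) (abs_ind_le_one _)) (abs_concord_le_one _ _)
  have Kcomm : ∀ x y, K x y = K y x := fun x y => by
    simp only [hK]; rw [concord_comm]; ring
  have mKx : ∀ x, Measurable (K x) := fun x => mK.comp (measurable_const.prodMk measurable_id)
  -- Centred because K(x, ·) integrates to g(x) and g integrates to D; by symmetry of K this gives
  -- degeneracy in both arguments.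
  have h0 : ∀ x, ∫ y, (K x y - g x - g y + bigD P A) ∂P = 0 := fun x => by
    have iK : Integrable (K x) P := integrable_of_measurable_of_bound (mKx x) (bK x)
    have ig : Integrable g P := integrable_of_measurable_of_bound mg bg
    rw [integral_add (f := fun y => K x y - g x - g y) ((iK.sub (integrable_const _)).sub ig)
      (integrable_const _), integral_sub (f := fun y => K x y - g x)
      (iK.sub (integrable_const _)) ig, integral_sub iK (integrable_const _),
      integral_concordMean hA]
    have : ∫ y, K x y ∂P = g x := by
      simp only [hg, concordMean]
      rw [← integral_const_mul]
      congr with y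
      simp only [hK]
      rw [concord_comm]
      ring
    rw [this]
    simp
  have hdeg := tendstoInMeasure_sum_degenerate hX hind
    (H := fun x y => K x y - g x - g y + bigD P A)
    (((mK.sub (mg.comp measurable_fst)).sub (mg.comp measurable_snd)).add_const _)
    (C := 1 + 1 + 1 + |bigD P A|)
    (fun x y => (abs_add_le _ _).trans (add_le_add ((abs_sub _ _).trans
      (add_le_add ((abs_sub _ _).trans (add_le_add (bK x y) (bg x))) (bg y))) le_rfl))
    h0 (fun y => by
      rw [← h0 y]
      congr with x
      rw [Kcomm]
      ring)
  refine hdeg.congr' ?_ (ae_of_all _ fun _ => rfl)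
  filter_upwards [eventually_gt_atTop 0] with n hn
  refine ae_of_all _ fun ω => ?_
  have hn' : (0 : ℝ) < n := by exact_mod_cast hn
  have hr : (0 : ℝ) < √n := Real.sqrt_pos.2 hn'
  have hsq : (n : ℝ) = √n ^ 2 := (Real.sq_sqrt hn'.le).symm
  beta_reduce
  rw [pairStat_eq_concord]
  simp only [Finset.sum_sub_distrib, Finset.sum_add_distrib, Finset.sum_const, Finset.card_univ,
    Fintype.card_fin, nsmul_eq_mul, ← Finset.mul_sum]
  generalize ∑ i : Fin n, ∑ j : Fin n, K (X i ω) (X j ω) = S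
  generalize ∑ i : Fin n, g (X i ω) = G
  generalize √(n : ℝ) = r at *
  rw [hsq]
  field_simp
  ring

/-- An exact expansion, with r = √n, so that no remainder estimate for the quotient is needed. It
rests on 1 + τ̂ = 4 dh / (ph (ph - 1/r²)). On the right, the coefficients of a and b tend to 0, the
second term carries the Hájek remainder, and the last one carries 1/r. -/
theorem linearization_identity {r p ph D dh a b : ℝ} (hr : r ≠ 0) (hp : p ≠ 0) (hph : ph ≠ 0)
    (hs : ph - 1 / r ^ 2 ≠ 0) (hb : b = r * (ph - p)) :
    r * (((4 * dh / ph ^ 2 - 1) / (1 - 1 / r ^ 2 * (1 / ph)) +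
      1 / r ^ 2 * (1 / ph) / (1 - 1 / r ^ 2 * (1 / ph))) - (4 * D / p ^ 2 - 1)) -
      (8 / p ^ 2 * a - 8 * D / p ^ 3 * b) =
    (8 / (ph * (ph - 1 / r ^ 2)) - 8 / p ^ 2) * a +
      4 / (ph * (ph - 1 / r ^ 2)) * (r * (dh - D) - 2 * a) -
      (4 * D * (ph + p) / (p ^ 2 * (ph * (ph - 1 / r ^ 2))) - 8 * D / p ^ 3) * b +
      4 * D * ph / (p ^ 2 * (ph * (ph - 1 / r ^ 2))) * (1 / r) := by
  have h1 : 1 / r = r * (1 / r ^ 2) := by field_simp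
  rw [h1]
  -- Trading 1/r² for t = ph - 1/r² leaves only denominators known to be nonzero.
  obtain ⟨t, ht⟩ : ∃ t, 1 / r ^ 2 = ph - t := ⟨ph - 1 / r ^ 2, by ring⟩
  rw [ht, sub_sub_cancel] at hs ⊢
  have h2 : 1 - (ph - t) * (1 / ph) = t / ph := by field_simp; ring
  rw [h2, hb]
  field_simp
  ring

theorem tendstoInMeasure_linearization (hX : ∀ i, HasLaw (X i) P μ) (hind : iIndepFun X μ)
    (hA : MeasurableSet A) (hpA : 0 < prob P A) (hc : ContinuousCondMargins P A) :
    TendstoInMeasure μ (fun (n : ℕ) ω =>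
      √n * (tauHat (fun i : Fin n => X i ω) A - condTau P A) -
        (√n)⁻¹ * ∑ i : Fin n, influence P A (X i ω)) atTop fun _ => 0 := by
  set p := prob P A with hp_def
  set D := bigD P A with hD_def
  set a : ℕ → Ω → ℝ := fun n ω =>
    (√n)⁻¹ * ∑ i : Fin n, (ind (cJ (X i ω) ∈ A) * concordMean P A (X i ω) - D) with ha
  set b : ℕ → Ω → ℝ := fun n ω => (√n)⁻¹ * ∑ i : Fin n, (ind (cJ (X i ω) ∈ A) - p) with hb
  set ph : ℕ → Ω → ℝ := fun n ω => pHat (fun i : Fin n => X i ω) A with hph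
  set qh : ℕ → Ω → ℝ := fun n ω => ph n ω * (ph n ω - 1 / n) with hqh
  have cp : TendstoInMeasure μ ph atTop fun _ => p := tendstoInMeasure_pHat hX hind hA
  have hp0 : p ≠ 0 := hpA.ne'
  have cq : TendstoInMeasure μ qh atTop fun _ => p ^ 2 := by
    have := tendstoInMeasure_const_mul cp
      (tendstoInMeasure_const_sub cp tendstoInMeasure_one_div_nat)
    simpa only [sub_zero, ← sq] using this
  have hp2 : p ^ 2 ≠ 0 := pow_ne_zero 2 hp0
  have mf : Measurable fun x => ind (cJ x ∈ A) * concordMean P A x - D :=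
    ((measurable_ind_cJ hA).mul (measurable_concordMean hA)).sub_const _
  have bf : ∀ x, |ind (cJ x ∈ A) * concordMean P A x - D| ≤ 1 + |D| := fun x =>
    (abs_sub _ _).trans (add_le_add (abs_ind_mul_concordMean_le_one x) le_rfl)
  have zf : ∫ x, (ind (cJ x ∈ A) * concordMean P A x - D) ∂P = 0 := by
    rw [integral_sub (integrable_ind_mul_concordMean hA) (integrable_const _),
      integral_concordMean hA]
    simp [hD_def]
  have mh : Measurable fun x : Vec q => ind (cJ x ∈ A) - p := (measurable_ind_cJ hA).sub_const _
  have bh : ∀ x : Vec q, |ind (cJ x ∈ A) - p| ≤ 1 + |p| := fun x =>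
    (abs_sub _ _).trans (add_le_add (abs_ind_le_one _) le_rfl)
  have zh : ∫ x, (ind (cJ x ∈ A) - p) ∂P = 0 := by
    rw [integral_sub (integrable_ind_cJ hA) (integrable_const _), ← prob_eq_integral hA]
    simp [hp_def]
  have c8 := tendstoInMeasure_const_sub
    (tendstoInMeasure_const_div hp2 (tendstoInMeasure_real_const (μ := μ) 8) cq)
    (tendstoInMeasure_real_const (μ := μ) (8 / p ^ 2))
  rw [sub_self] at c8
  have t1 := tendstoInMeasure_zero_mul_of_integral_sq_le c8
    (fun n => integrable_sq_sum_sample hX mf bf (√n)⁻¹ n)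
    (integral_sq_sum_sample_le hX hind mf bf zf)
  have t2 := tendstoInMeasure_const_mul
    (tendstoInMeasure_const_div hp2 (tendstoInMeasure_real_const (μ := μ) 4) cq)
    (tendstoInMeasure_hajek_remainder hX hind hA)
  have c3 := tendstoInMeasure_const_sub (tendstoInMeasure_const_div (mul_ne_zero hp2 hp2)
    (tendstoInMeasure_const_mul (tendstoInMeasure_real_const (μ := μ) (4 * D))
      (tendstoInMeasure_const_add cp (tendstoInMeasure_real_const (μ := μ) p)))
    (tendstoInMeasure_const_mul (tendstoInMeasure_real_const (μ := μ) (p ^ 2)) cq))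
    (tendstoInMeasure_real_const (μ := μ) (8 * D / p ^ 3))
  -- As p̂ tends to p, the first quotient tends to 8D/p³; this cancellation dictates the second
  -- coefficient in `influence`.
  have e3 : 4 * D * (p + p) / (p ^ 2 * p ^ 2) - 8 * D / p ^ 3 = 0 := by
    field_simp
    ring
  rw [e3] at c3
  have t3 := tendstoInMeasure_zero_mul_of_integral_sq_le c3
    (fun n => integrable_sq_sum_sample hX mh bh (√n)⁻¹ n)
    (integral_sq_sum_sample_le hX hind mh bh zh)
  have hsqrt : Tendsto (fun n : ℕ => 1 / √(n : ℝ)) atTop (nhds 0) :=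
    (tendsto_const_nhds (x := (1 : ℝ))).div_atTop
      (Real.tendsto_sqrt_atTop.comp tendsto_natCast_atTop_atTop)
  have t4 := tendstoInMeasure_const_mul (tendstoInMeasure_const_div (mul_ne_zero hp2 hp2)
    (tendstoInMeasure_const_mul (tendstoInMeasure_real_const (μ := μ) (4 * D)) cp)
    (tendstoInMeasure_const_mul (tendstoInMeasure_real_const (μ := μ) (p ^ 2)) cq))
    (tendstoInMeasure_of_deterministic (μ := μ) hsqrt)
  have t := tendstoInMeasure_const_add (tendstoInMeasure_const_sub
    (tendstoInMeasure_const_add t1 t2) t3) t4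
  simp only [mul_zero, add_zero, sub_zero] at t
  -- The identity is needed only where p̂ > p/2; with n > 2/p this gives p̂ - 1/n > 0, so every
  -- denominator is nonzero.
  refine tendstoInMeasure_congr_of_mem_nhds cp (Ioi_mem_nhds (half_lt_self hpA)) ?_ t
  have hlarge : ∀ᶠ n : ℕ in atTop, 2 / p < n :=
    tendsto_natCast_atTop_atTop.eventually_gt_atTop (2 / p)
  filter_upwards [eventually_gt_atTop 0, hlarge] with n hn hnp ω hω
  have hn' : (0 : ℝ) < n := by exact_mod_cast hn
  have hr : (0 : ℝ) < √n := Real.sqrt_pos.2 hn'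
  have hsq : (n : ℝ) = √n ^ 2 := (Real.sq_sqrt hn'.le).symm
  have hω' : p / 2 < ph n ω := hω
  have hph0 : 0 < ph n ω := (half_pos hpA).trans hω'
  have hlt : 1 / (n : ℝ) < p / 2 := by
    rw [div_lt_iff₀ hpA] at hnp
    rw [div_lt_div_iff₀ hn' two_pos]
    linarith
  have hs : ph n ω - 1 / (√n) ^ 2 ≠ 0 := by
    rw [← hsq]
    exact (sub_pos.2 (hlt.trans hω')).ne'
  have hbn : b n ω = √n * (ph n ω - p) := by
    simp only [hb, hph, pHat, Finset.sum_sub_distrib, Finset.sum_const, Finset.card_univ,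
      Fintype.card_fin, nsmul_eq_mul]
    generalize ∑ i : Fin n, ind (cJ (X i ω) ∈ A) = S
    generalize √(n : ℝ) = r at *
    rw [hsq]
    field_simp
  have hid := linearization_identity (D := D) (dh := pairStat (fun i : Fin n => X i ω) A)
    (a := a n ω) hr.ne' hp0 hph0.ne' hs hbn
  rw [← hsq] at hid
  rw [tauHat_eq hn, condTau_eq hA hpA hc]
  have hinf : (√n)⁻¹ * ∑ i : Fin n, influence P A (X i ω) =
      8 / p ^ 2 * a n ω - 8 * D / p ^ 3 * b n ω := by
    simp only [ha, hb, influence, Finset.sum_sub_distrib, Finset.sum_const, Finset.card_univ,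
      Fintype.card_fin, nsmul_eq_mul, ← Finset.mul_sum, ← hp_def, ← hD_def]
    field_simp
    ring
  rw [hinf]
  exact hid

end Linearization

/-! ### Measurability of the statistics -/

section Measurability

variable {q m n r : ℕ} {A B : Set (Fin q → ℝ)}

theorem measurable_count (hA : MeasurableSet A) :
    Measurable fun x : Fin n → Vec q => count x A :=
  Finset.measurable_fun_sum _ fun i _ => (measurable_ind_cJ hA).comp (measurable_pi_apply i)

theorem measurable_weight (hA : MeasurableSet A) (i : Fin n) :
    Measurable fun x : Fin n → Vec q => weight x A i :=
  ((measurable_ind_cJ hA).comp (measurable_pi_apply i)).div (measurable_count hA)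

theorem measurable_pHat (hA : MeasurableSet A) :
    Measurable fun x : Fin n → Vec q => pHat x A :=
  (measurable_count hA).const_mul _

theorem measurable_pair (i j : Fin n) : Measurable fun x : Fin n → Vec q => (x i, x j) := by
  fun_prop

theorem measurable_tauHat (hA : MeasurableSet A) :
    Measurable fun x : Fin n → Vec q => tauHat x A := by
  have h1 : Measurable fun x : Fin n → Vec q => tauHat1 x A :=
    ((Finset.measurable_fun_sum _ fun i _ => Finset.measurable_fun_sum _ fun j _ =>
      ((measurable_weight hA i).mul (measurable_weight hA j)).mul
        (measurable_concordance_ind.comp (measurable_pair i j))).const_mul 4).sub_const 1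
  have h2 : Measurable fun x : Fin n → Vec q => sHat x A :=
    Finset.measurable_fun_sum _ fun i _ => (measurable_weight hA i).pow_const 2
  exact (h1.div (h2.const_sub 1)).add (h2.div (h2.const_sub 1))

theorem measurable_pairStat (hA : MeasurableSet A) :
    Measurable fun x : Fin n → Vec q => pairStat x A :=
  (Finset.measurable_fun_sum _ fun i _ => Finset.measurable_fun_sum _ fun j _ =>
    (measurable_pairKernel hA).comp (measurable_pair i j)).const_mul _

theorem measurable_DHat (hA : MeasurableSet A) :
    Measurable fun x : Fin n → Vec q => DHat x A := by
  simp only [DHat_eq]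
  exact (measurable_pairStat hA).const_mul _

theorem measurable_IHat (hA : MeasurableSet A) (hB : MeasurableSet B) :
    Measurable fun x : Fin n → Vec q => IHat x A B := by
  simp only [IHat, ind_and]
  refine Measurable.mul (Measurable.const_div (((measurable_pHat hA).mul
    (measurable_pHat hB)).const_mul _) 1) ?_
  exact Finset.measurable_fun_sum _ fun i _ => Finset.measurable_fun_sum _ fun j _ =>
    Finset.measurable_fun_sum _ fun k _ =>
      ((measurable_concord.comp (measurable_pair i k)).mul
        (measurable_concord.comp (measurable_pair j k))).mul
        (((measurable_ind_cJ hA).comp (measurable_pi_apply i)).mul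
          (((measurable_ind_cJ hB).comp (measurable_pi_apply j)).mul
            ((measurable_ind_cJ (hA.inter hB)).comp (measurable_pi_apply k))))

theorem measurable_JHat (hA : MeasurableSet A) (hB : MeasurableSet B) :
    Measurable fun x : Fin n → Vec q => JHat x A B := by
  simp only [JHat, ind_and]
  refine Measurable.mul (Measurable.const_div ((measurable_pHat hA).const_mul _) 1) ?_
  exact Finset.measurable_fun_sum _ fun i _ => Finset.measurable_fun_sum _ fun j _ =>
    (measurable_concord.comp (measurable_pair i j)).mul
      (((measurable_ind_cJ hA).comp (measurable_pi_apply i)).mul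
        ((measurable_ind_cJ (hA.inter hB)).comp (measurable_pi_apply j)))

theorem measurable_DeltaHat {A : Fin m → Set (Fin q → ℝ)} (hA : ∀ k, MeasurableSet (A k))
    (k l : Fin m) : Measurable fun x : Fin n → Vec q => DeltaHat A x k l := by
  have pk := measurable_pHat (n := n) (hA k)
  have pl := measurable_pHat (n := n) (hA l)
  have pkl := measurable_pHat (n := n) ((hA k).inter (hA l))
  have dk := measurable_DHat (n := n) (hA k)
  have dl := measurable_DHat (n := n) (hA l)
  have i := measurable_IHat (n := n) (hA k) (hA l)
  have jk := measurable_JHat (n := n) (hA k) (hA l)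
  have jl := measurable_JHat (n := n) (hA l) (hA k)
  simp only [DeltaHat, Matrix.of_apply]
  fun_prop

theorem measurable_DeltaHatDisjoint {A : Fin m → Set (Fin q → ℝ)}
    (hA : ∀ k, MeasurableSet (A k)) (k l : Fin m) :
    Measurable fun x : Fin n → Vec q => DeltaHatDisjoint A x k l := by
  by_cases hkl : k = l
  · subst hkl
    have pk := measurable_pHat (n := n) (hA k)
    have i := measurable_IHat (n := n) (hA k) (hA k)
    have t := measurable_tauHat (n := n) (hA k)
    simp only [DeltaHatDisjoint, Matrix.diagonal_apply_eq]
    fun_prop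
  · simp only [DeltaHatDisjoint, Matrix.diagonal_apply_ne _ hkl]
    exact measurable_const

theorem measurable_WHat (P : Measure (Vec q)) {A : Fin m → Set (Fin q → ℝ)}
    (hA : ∀ k, MeasurableSet (A k)) (k : Fin m) :
    Measurable fun x : Fin n → Vec q => WHat P A x k :=
  ((measurable_tauHat (hA k)).sub_const _).const_mul _

variable {E : Type*} [MeasurableSpace E]

theorem measurable_matrix_mul {l₁ l₂ l₃ : Type*} [Fintype l₂] {M : E → Matrix l₁ l₂ ℝ}
    {N : E → Matrix l₂ l₃ ℝ} (hM : ∀ a b, Measurable fun x => M x a b)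
    (hN : ∀ a b, Measurable fun x => N x a b) (a : l₁) (b : l₃) :
    Measurable fun x => (M x * N x) a b := by
  simp only [Matrix.mul_apply]
  exact Finset.measurable_fun_sum _ fun c _ => (hM a c).mul (hN c b)

theorem measurable_matrix_det {ι : Type*} [Fintype ι] [DecidableEq ι] {M : E → Matrix ι ι ℝ}
    (hM : ∀ a b, Measurable fun x => M x a b) : Measurable fun x => (M x).det := by
  simp only [Matrix.det_apply]
  exact Finset.measurable_fun_sum _ fun σ _ =>
    (Finset.measurable_fun_prod _ fun i _ => hM (σ i) i).const_smul _

/-- By the adjugate formula the entries are determinants times the inverse of a determinant. With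
the inverse of 0 equal to 0, this holds for singular matrices too. -/
theorem measurable_matrix_inv {ι : Type*} [Fintype ι] [DecidableEq ι] {M : E → Matrix ι ι ℝ}
    (hM : ∀ a b, Measurable fun x => M x a b) (a b : ι) : Measurable fun x => (M x)⁻¹ a b := by
  simp only [Matrix.inv_def, Ring.inverse_eq_inv', Matrix.smul_apply, smul_eq_mul,
    Matrix.adjugate_apply]
  refine (measurable_matrix_det hM).inv.mul (measurable_matrix_det fun c d => ?_)
  by_cases hc : c = b
  · simp [Matrix.updateRow_apply, hc]
  · simpa [Matrix.updateRow_apply, hc] using hM c d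

theorem measurable_mulVec {l₁ l₂ : Type*} [Fintype l₂] (T : Matrix l₁ l₂ ℝ) {W : E → l₂ → ℝ}
    (hW : ∀ a, Measurable fun x => W x a) (a : l₁) : Measurable fun x => (T *ᵥ W x) a := by
  simp only [Matrix.mulVec, dotProduct]
  exact Finset.measurable_fun_sum _ fun c _ => (hW c).const_mul _

end Measurability

/-! ### The Wald statistic -/

section Wald

variable {Ω : Type*} [MeasurableSpace Ω] {μ : Measure Ω} [IsProbabilityMeasure μ]
  {q m r : ℕ} {P : Measure (Vec q)} [IsProbabilityMeasure P] {X : ℕ → Ω → Vec q}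
  {A : Fin m → Set (Fin q → ℝ)}

theorem integral_influence_mul_eq_Delta (hA : ∀ k, MeasurableSet (A k))
    (hp : ∀ k, 0 < prob P (A k)) (k l : Fin m) :
    ∫ x, influence P (A k) x * influence P (A l) x ∂P = Delta P A k l := by
  rw [integral_influence_mul (hA k) (hA l) (hp k) (hp l)]
  rfl

theorem integrable_influence_mul (hA : ∀ k, MeasurableSet (A k)) (k l : Fin m) :
    Integrable (fun x => influence P (A k) x * influence P (A l) x) P :=
  integrable_of_measurable_of_bound ((measurable_influence (hA k)).mul
    (measurable_influence (hA l)))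
    fun x => by
      rw [abs_mul]
      exact mul_le_mul (abs_influence_le x) (abs_influence_le x) (abs_nonneg _)
        ((abs_nonneg _).trans (abs_influence_le x))

theorem integral_mulVec_influence_mul (hA : ∀ k, MeasurableSet (A k))
    (hp : ∀ k, 0 < prob P (A k)) (R : Matrix (Fin r) (Fin m) ℝ) (a b : Fin r) :
    ∫ x, (R *ᵥ fun k => influence P (A k) x) a * (R *ᵥ fun k => influence P (A k) x) b ∂P =
      (R * Delta P A * Rᵀ) a b := by
  have hexp : ∀ x, (R *ᵥ fun k => influence P (A k) x) a * (R *ᵥ fun k => influence P (A k) x) b =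
      ∑ k, ∑ l, R a k * R b l * (influence P (A k) x * influence P (A l) x) := fun x => by
    simp only [Matrix.mulVec, dotProduct, Finset.sum_mul_sum]
    refine Finset.sum_congr rfl fun k _ => Finset.sum_congr rfl fun l _ => ?_
    ring
  simp_rw [hexp]
  rw [integral_finsetSum _ fun k _ => integrable_finsetSum _ fun l _ =>
    (integrable_influence_mul hA k l).const_mul _]
  simp only [Matrix.mul_apply, Finset.sum_mul, Matrix.transpose_apply]
  rw [Finset.sum_comm]
  refine Finset.sum_congr rfl fun k _ => ?_
  rw [integral_finsetSum _ fun l _ => (integrable_influence_mul hA k l).const_mul _]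
  refine Finset.sum_congr rfl fun l _ => ?_
  rw [integral_const_mul, integral_influence_mul_eq_Delta hA hp]
  ring

/-- `Delta` is the second moment matrix of the influence functions, so t'Δt is the integral of a
square; the row matrix with single row t exhibits this. -/
theorem posSemidef_mul_Delta_mul (hA : ∀ k, MeasurableSet (A k))
    (hp : ∀ k, 0 < prob P (A k)) (R : Matrix (Fin r) (Fin m) ℝ) :
    (R * Delta P A * Rᵀ).PosSemidef := by
  have hD : (Delta P A).PosSemidef := by
    refine .of_dotProduct_mulVec_nonneg ?_ fun t => ?_
    · ext k l
      rw [Matrix.conjTranspose_apply, star_trivial, ← integral_influence_mul_eq_Delta hA hp,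
        ← integral_influence_mul_eq_Delta hA hp]
      congr with x
      ring
    · have h := integral_mulVec_influence_mul hA hp (Matrix.of fun _ : Fin 1 => t) 0 0
      have h2 : (Matrix.of (fun _ : Fin 1 => t) * Delta P A * (Matrix.of fun _ : Fin 1 => t)ᵀ) 0 0
          = star t ⬝ᵥ (Delta P A *ᵥ t) := by
        rw [Matrix.mul_assoc]
        simp [Matrix.mul_apply, dotProduct, Matrix.mulVec]
      rw [← h2, ← h]
      exact integral_nonneg fun x => mul_self_nonneg _
  have := hD.mul_mul_conjTranspose_same R
  rwa [Matrix.conjTranspose_eq_transpose_of_trivial] at this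

open scoped MatrixOrder in
/-- A nonsingular positive semidefinite matrix has a symmetric nonsingular square root. -/
theorem exists_sqrt_of_posSemidef {ι : Type*} [Fintype ι] [DecidableEq ι] {S : Matrix ι ι ℝ}
    (hS : S.PosSemidef) (hdet : S.det ≠ 0) :
    ∃ B : Matrix ι ι ℝ, IsUnit B.det ∧ Bᵀ = B ∧ B * B = S := by
  have h := CFC.sqrt_mul_sqrt_self S hS.nonneg
  refine ⟨CFC.sqrt S, ?_, ?_, h⟩
  · rw [← h, Matrix.det_mul] at hdet
    exact isUnit_iff_ne_zero.2 (left_ne_zero_of_mul hdet)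
  · have := (Matrix.nonneg_iff_posSemidef.1 (CFC.sqrt_nonneg S)).isHermitian
    rwa [Matrix.IsHermitian, Matrix.conjTranspose_eq_transpose_of_trivial] at this

theorem map_sq_sum_stdGaussian (r : ℕ) :
    (stdGaussian (EuclideanSpace ℝ (Fin r))).map (fun z => ∑ a, z a ^ 2) = chiSquared r := by
  rw [← map_pi_eq_stdGaussian, Measure.map_map (by fun_prop) (by fun_prop)]
  rfl

/-- Convergence in distribution sees only the law of the limit, so the limit may be moved from the
Gaussian space to the chi-squared law on ℝ. -/
theorem tendstoInDistribution_of_map_eq {Ω₁ Ω₂ : Type*} [MeasurableSpace Ω₁] [MeasurableSpace Ω₂]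
    {ν₁ : Measure Ω₁} {ν₂ : Measure Ω₂} [IsProbabilityMeasure ν₁] [IsProbabilityMeasure ν₂]
    {Y : ℕ → Ω → ℝ} {Z₁ : Ω₁ → ℝ} {Z₂ : Ω₂ → ℝ}
    (h : TendstoInDistribution Y atTop Z₁ (fun _ => μ) ν₁) (hZ : AEMeasurable Z₂ ν₂)
    (hmap : ν₁.map Z₁ = ν₂.map Z₂) : TendstoInDistribution Y atTop Z₂ (fun _ => μ) ν₂ where
  forall_aemeasurable := h.forall_aemeasurable
  aemeasurable_limit := hZ
  tendsto := by
    have heq : (⟨ν₂.map Z₂, Measure.isProbabilityMeasure_map hZ⟩ : ProbabilityMeasure ℝ) =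
        ⟨ν₁.map Z₁, Measure.isProbabilityMeasure_map h.aemeasurable_limit⟩ :=
      Subtype.ext hmap.symm
    rw [heq]
    exact h.tendsto

/-- The hypothesis on `R` says that it whitens the influence functions; the linearization errors
pass through the fixed matrix `R` and remain negligible. -/
theorem tendstoInDistribution_mulVec_WHat (hX : ∀ i, HasLaw (X i) P μ) (hind : iIndepFun X μ)
    (hA : ∀ k, MeasurableSet (A k)) (hp : ∀ k, 0 < prob P (A k))
    (hc : ∀ k, ContinuousCondMargins P (A k)) {R : Matrix (Fin r) (Fin m) ℝ}
    (hR : R * Delta P A * Rᵀ = 1) :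
    TendstoInDistribution (fun (n : ℕ) ω =>
      (WithLp.toLp 2 (R *ᵥ WHat P A fun i : Fin n => X i ω) : EuclideanSpace ℝ (Fin r))) atTop
      (fun z => z) (fun _ => μ) (stdGaussian (EuclideanSpace ℝ (Fin r))) := by
  set η : Vec q → EuclideanSpace ℝ (Fin r) :=
    fun x => WithLp.toLp 2 (R *ᵥ fun k => influence P (A k) x) with hη
  have mη : Measurable η := by
    refine (by fun_prop : Measurable (WithLp.toLp 2 : (Fin r → ℝ) → EuclideanSpace ℝ (Fin r))).comp
      (measurable_pi_lambda _ fun a => ?_)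
    exact measurable_mulVec R (fun k => measurable_influence (hA k)) a
  have bη : ∀ x, ‖η x‖ ≤ ∑ a, ∑ k, |R a k| *
      (|8 / prob P (A k) ^ 2| + |8 * bigD P (A k) / prob P (A k) ^ 3|) := fun x => by
    refine (?_ : ‖η x‖ ≤ ∑ a, |η x a|).trans (Finset.sum_le_sum fun a _ => ?_)
    · have h : η x = ∑ a, EuclideanSpace.single a (η x a) := by
        ext b
        simp [Finset.sum_apply, Pi.single_apply]
      calc ‖η x‖ = ‖∑ a, EuclideanSpace.single a (η x a)‖ := by rw [← h]
        _ ≤ ∑ a, ‖EuclideanSpace.single a (η x a)‖ := norm_sum_le _ _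
        _ = _ := by simp
    · have h : η x a = ∑ k, R a k * influence P (A k) x := rfl
      rw [h]
      refine (Finset.abs_sum_le_sum_abs _ _).trans (Finset.sum_le_sum fun k _ => ?_)
      rw [abs_mul]
      exact mul_le_mul_of_nonneg_left (abs_influence_le x) (abs_nonneg _)
  have hclt := tendstoInDistribution_sum_stdGaussian hX hind mη bη
    (fun a => by
      simp only [hη, Matrix.mulVec, dotProduct]
      rw [integral_finsetSum _ fun k _ => (integrable_of_measurable_of_bound
        (measurable_influence (hA k)) abs_influence_le).const_mul _]
      simp [integral_const_mul, integral_influence (hA _) (hp _)])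
    (fun a b => by rw [← hR]; exact integral_mulVec_influence_mul hA hp R a b)
  refine tendstoInDistribution_of_tendstoInMeasure_sub _ _ hclt ?_ fun n => ?_
  · have hrem : TendstoInMeasure μ (fun (n : ℕ) ω a => ∑ k, R a k *
        (√n * (tauHat (fun i : Fin n => X i ω) (A k) - condTau P (A k)) -
          (√n)⁻¹ * ∑ i : Fin n, influence P (A k) (X i ω))) atTop fun _ => (0 : Fin r → ℝ) := by
      refine tendstoInMeasure_const_pi fun a => ?_
      have := tendstoInMeasure_finset_sum (μ := μ) Finset.univ fun k _ =>
        tendstoInMeasure_const_mul (tendstoInMeasure_real_const (R a k))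
          (tendstoInMeasure_linearization hX hind (hA k) (hp k) (hc k))
      simpa using this
    have hcont : ContinuousAt (WithLp.toLp 2 : (Fin r → ℝ) → EuclideanSpace ℝ (Fin r)) 0 := by
      fun_prop
    have h := tendstoInMeasure_const_comp hcont hrem
    rw [WithLp.toLp_zero] at h
    refine h.congr (fun n => ae_of_all _ fun ω => ?_) (ae_of_all _ fun _ => rfl)
    ext a
    simp only [hη, Pi.sub_apply, PiLp.sub_apply, PiLp.smul_apply, smul_eq_mul, WithLp.ofLp_sum,
      Finset.sum_apply, Matrix.mulVec, dotProduct, WHat]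
    rw [Finset.sum_comm, Finset.mul_sum, ← Finset.sum_sub_distrib]
    refine Finset.sum_congr rfl fun k _ => ?_
    rw [← Finset.mul_sum]
    ring
  · refine (by fun_prop : Measurable (WithLp.toLp 2 : (Fin r → ℝ) →
      EuclideanSpace ℝ (Fin r))).comp_aemeasurable (aemeasurable_pi_lambda _ fun a => ?_)
    exact (measurable_mulVec R (fun k => measurable_WHat P hA k) a).comp_aemeasurable
      (hasLaw_sample hX hind n).aemeasurable

/-- The Wald statistic built from a consistent estimator of `Delta` is asymptotically
chi-squared. -/
theorem tendstoInDistribution_waldStat (hX : ∀ i, HasLaw (X i) P μ) (hind : iIndepFun X μ)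
    (hA : ∀ k, MeasurableSet (A k)) (hp : ∀ k, 0 < prob P (A k))
    (hc : ∀ k, ContinuousCondMargins P (A k)) {T : Matrix (Fin r) (Fin m) ℝ}
    (hT : (T * Delta P A * Tᵀ).det ≠ 0)
    {S : ∀ n : ℕ, (Fin n → Vec q) → Matrix (Fin m) (Fin m) ℝ}
    (hS_meas : ∀ n k l, Measurable fun x => S n x k l)
    (hS : ∀ k l, TendstoInMeasure μ (fun (n : ℕ) ω => S n (fun i : Fin n => X i ω) k l) atTop
      fun _ => Delta P A k l) :
    TendstoInDistribution (fun (n : ℕ) ω => waldStat T (S n fun i : Fin n => X i ω)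
      (WHat P A fun i : Fin n => X i ω)) atTop (fun z : ℝ => z) (fun _ => μ) (chiSquared r) := by
  obtain ⟨B, hBu, hBt, hBS⟩ := exists_sqrt_of_posSemidef (posSemidef_mul_Delta_mul hA hp T) hT
  have hBB : B * B⁻¹ = 1 := Matrix.mul_nonsing_inv B hBu
  have hBB' : B⁻¹ * B = 1 := Matrix.nonsing_inv_mul B hBu
  have hR : (B⁻¹ * T) * Delta P A * (B⁻¹ * T)ᵀ = 1 := by
    rw [Matrix.transpose_mul, Matrix.transpose_nonsing_inv, hBt]
    calc B⁻¹ * T * Delta P A * (Tᵀ * B⁻¹) = B⁻¹ * (T * Delta P A * Tᵀ) * B⁻¹ := by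
          simp only [Matrix.mul_assoc]
      _ = (B⁻¹ * B) * (B * B⁻¹) := by rw [← hBS]; simp only [Matrix.mul_assoc]
      _ = 1 := by rw [hBB, hBB', Matrix.mul_one]
  have hY := tendstoInDistribution_mulVec_WHat hX hind hA hp hc hR
  -- The quadratic form seen in whitened coordinates. At `Delta` it is B(BB)⁻¹B = 1, and
  -- nonsingularity there gives the only continuity needed.
  set f : (Fin m → Fin m → ℝ) → Fin r → Fin r → ℝ :=
    fun M a b => (B * (T * Matrix.of M * Tᵀ)⁻¹ * B) a b with hf
  have hfc : ContinuousAt f (Delta P A) := by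
    have h1 : Continuous fun M : Matrix (Fin m) (Fin m) ℝ => T * M * Tᵀ := by fun_prop
    have h2 : ContinuousAt (Inv.inv : Matrix (Fin r) (Fin r) ℝ → _) (T * Delta P A * Tᵀ) := by
      refine continuousAt_matrix_inv _ ?_
      rw [Ring.inverse_eq_inv']
      exact continuousAt_inv₀ hT
    have h3 : Continuous fun M : Matrix (Fin r) (Fin r) ℝ => B * M * B := by fun_prop
    exact h3.continuousAt.comp (ContinuousAt.comp
      (f := fun M : Matrix (Fin m) (Fin m) ℝ => T * M * Tᵀ) h2 h1.continuousAt)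
  have hN := tendstoInMeasure_const_comp hfc (tendstoInMeasure_const_pi fun k =>
    tendstoInMeasure_const_pi fun l => hS k l)
  have hf1 : f (Delta P A) = (1 : Matrix (Fin r) (Fin r) ℝ) := by
    have h : B * (T * Delta P A * Tᵀ)⁻¹ * B = 1 := by
      rw [← hBS, Matrix.mul_inv_rev, ← Matrix.mul_assoc, hBB, Matrix.one_mul, hBB']
    rw [← h]
    rfl
  rw [hf1] at hN
  have mN : ∀ n : ℕ, AEMeasurable (fun ω => f (S n fun i : Fin n => X i ω)) μ := fun n => by
    have : Measurable fun x : Fin n → Vec q => f (S n x) := by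
      refine measurable_pi_lambda _ fun a => measurable_pi_lambda _ fun b => ?_
      have h1 : ∀ c d, Measurable fun x : Fin n → Vec q => (T * S n x * Tᵀ) c d :=
        measurable_matrix_mul (N := fun _ => Tᵀ) (measurable_matrix_mul (M := fun _ => T)
          (fun _ _ => measurable_const) (hS_meas n)) fun _ _ => measurable_const
      exact measurable_matrix_mul (N := fun _ => B) (measurable_matrix_mul (M := fun _ => B)
        (fun _ _ => measurable_const) (measurable_matrix_inv h1)) (fun _ _ => measurable_const) a b
    exact this.comp_aemeasurable (hasLaw_sample hX hind n).aemeasurable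
  set g : EuclideanSpace ℝ (Fin r) × (Fin r → Fin r → ℝ) → ℝ :=
    fun z => ∑ a, z.1 a * ∑ b, z.2 a b * z.1 b with hg
  have hgc : Continuous g := by fun_prop
  have h := hY.continuous_comp_prodMk_of_tendstoInMeasure_const hgc hN mN
  -- Only B is cancelled, never TMT', so this holds even for singular TMT' and the exceptional event
  -- needs no separate treatment.
  have hwald : ∀ (M : Matrix (Fin m) (Fin m) ℝ) (W : Fin m → ℝ),
      g (WithLp.toLp 2 ((B⁻¹ * T) *ᵥ W), f M) = waldStat T M W := fun M W => by
    have h1 : g (WithLp.toLp 2 ((B⁻¹ * T) *ᵥ W), f M) =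
        ((B⁻¹ * T) *ᵥ W) ⬝ᵥ ((B * (T * M * Tᵀ)⁻¹ * B) *ᵥ ((B⁻¹ * T) *ᵥ W)) := rfl
    have h2 : (B * (T * M * Tᵀ)⁻¹ * B) *ᵥ ((B⁻¹ * T) *ᵥ W) =
        B *ᵥ ((T * M * Tᵀ)⁻¹ *ᵥ (T *ᵥ W)) := by
      simp only [Matrix.mulVec_mulVec]
      congr 1
      rw [Matrix.mul_assoc, ← Matrix.mul_assoc B B⁻¹, hBB, Matrix.one_mul]
      simp only [Matrix.mul_assoc]
    have h3 : Matrix.vecMul ((B⁻¹ * T) *ᵥ W) B = T *ᵥ W := by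
      rw [← Matrix.mulVec_transpose, hBt, Matrix.mulVec_mulVec, ← Matrix.mul_assoc, hBB,
        Matrix.one_mul]
    rw [h1, h2, Matrix.dotProduct_mulVec, h3, waldStat]
  simp only [hwald] at h
  refine tendstoInDistribution_of_map_eq h (by fun_prop) ?_
  rw [Measure.map_id', ← map_sq_sum_stdGaussian]
  congr with z
  simp only [hg, Matrix.one_apply, ite_mul, one_mul, zero_mul, Finset.sum_ite_eq,
    Finset.mem_univ, if_true, sq]

end Wald

end CondKendall

theorem mainTheorem3 {Ω : Type*} [MeasurableSpace Ω] (μ : Measure Ω) [IsProbabilityMeasure μ]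
    (q m : ℕ) (hm : 1 ≤ m)
    (P : Measure (CondKendall.Vec q)) [IsProbabilityMeasure P]
    (X : ℕ → Ω → CondKendall.Vec q)
    (hX_law : ∀ i, HasLaw (X i) P μ) (hX_indep : iIndepFun X μ)
    (A : Fin m → Set (Fin q → ℝ)) (hA_meas : ∀ k, MeasurableSet (A k))
    (hA_pos : ∀ k, 0 < CondKendall.prob P (A k))
    (hcont : ∀ k, CondKendall.ContinuousCondMargins P (A k))
    (T : Matrix (Fin (m - 1)) (Fin m) ℝ)
    (hT : CondKendall.IsContrast T) (hT_rank : T.rank = m - 1)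
    (hnondeg : (T * CondKendall.Delta P A * Tᵀ).det ≠ 0)
    (hnull : ∀ k l, CondKendall.condTau P (A k) = CondKendall.condTau P (A l)) :
    TendstoInDistribution
      (fun (n : ℕ) (ω : Ω) =>
        CondKendall.waldStat T (CondKendall.DeltaHat A fun i : Fin n => X i ω)
          (CondKendall.WHat P A fun i : Fin n => X i ω))
      atTop (fun z : ℝ => z) (fun _ => μ) (CondKendall.chiSquared (m - 1)) ∧
    (Pairwise (fun k l => Disjoint (A k) (A l)) →
      TendstoInDistribution
        (fun (n : ℕ) (ω : Ω) =>
          CondKendall.waldStat T (CondKendall.DeltaHatDisjoint A fun i : Fin n => X i ω)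
            (CondKendall.WHat P A fun i : Fin n => X i ω))
        atTop (fun z : ℝ => z) (fun _ => μ) (CondKendall.chiSquared (m - 1))) := by
  -- Both estimators have measurable entries consistent for those of `Delta`. For m = 1 the matrix T
  -- has no rows, and the limit is the law of an empty sum of squares.
  refine ⟨?_, fun hdisj => ?_⟩
  · exact CondKendall.tendstoInDistribution_waldStat hX_law hX_indep hA_meas hA_pos hcont hnondeg
      (S := fun n x => CondKendall.DeltaHat A x)
      (fun n => CondKendall.measurable_DeltaHat hA_meas)
      (CondKendall.tendstoInMeasure_DeltaHat hX_law hX_indep hA_meas hA_pos)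
  · exact CondKendall.tendstoInDistribution_waldStat hX_law hX_indep hA_meas hA_pos hcont hnondeg
      (S := fun n x => CondKendall.DeltaHatDisjoint A x)
      (fun n => CondKendall.measurable_DeltaHatDisjoint hA_meas)
      (CondKendall.tendstoInMeasure_DeltaHatDisjoint hX_law hX_indep hA_meas hA_pos hcont hdisj)
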